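/- Let $G=(V,E)$ be a finite simple graph with a universal vertex $univ$ (adjacent to all other vertices), let $C\subseteq V$ be a vertex cover of $G$ with $univ\in C$, and let $S=V\setminus C$. **Traces.** For a node $i$ of a rooted tree decomposition of $G$ with bags $X_i$, let $V_i$ be the union of the bags in the subtree rooted at $i$, $L_i=V_i\setminus X_i$, $R_i=V\setminus V_i$. The trace of $i$ on $C$ is $(L_i\cap C, X_i\cap C, R_i\cap C)$. A partition $(L,X,R)$ of $C$ is *valid* if it is the trace of some node of some rooted tree decomposition of $G$. **Nice tree decompositions** are rooted tree decompositions with root bag $\{univ\}$ whose nodes are of four types, each with an operation: leaves with a bag $\{u\}$ (operation $introduce(u)$); nodes $i$ with one child $j$ and $X_i=X_j\cup\{u\}$, $u\notin X_j$ ($introduce(u)$); nodes $i$ with one child $j$ and $X_i=X_j\setminus\{u\}$, $u\in X_j$ ($forget(u)$); nodes $i$ with two children $j,k$ and $X_i=X_j=X_k$ ($join(X_i;L_j,L_k)$, the order of the children being irrelevant). Operations are considered on $C$, i.e. $join(X;L_1,L_2)$ is read as $join(X\cap C;L_1\cap C,L_2\cap C)$. **Valid quintuples.** A quintuple $Q=(\tau_-,L,X,R,\tau_+)$,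 where $\tau_\pm$ are operations, is valid in the following two cases. * $L\neq\emptyset$, $(L,X,R)$ is a valid partition of $C$, and there is a nice tree decomposition of $G$ in which some node has trace $(L,X,R)$, and such that, if $imin$ and $imax$ are the lowest and the highest node with this trace, then $\tau_-$ is the operation of $imin$ and $\tau_+$ is the operation of the father of $imax$ (if $imax$ is the root, $\tau_+$ is the operation that forgets the unique vertex of the root bag). * (*degenerate*) $L=\emptyset$, $(\emptyset,X,R)$ is a valid partition of $C$, and $\tau_+=forget(u)$ for some $u\in X$ with $N(u)\cap C\subseteq X$; here $\tau_-$ is arbitrary. **Local treewidth.** Let $XTR(Q)$ be the set of $x\in S$ with $N(x)\cap L\ne\emptyset$ and $N(x)\cap R\neq\emptyset$. Let $XL(Q)$ be: the set of $x\in S$ with $N(x)\subseteq L\cup X$, $u\in N(x)$ and $N(x)\cap L\neq\emptyset$, if $\tau_-=introduce(u)$ and $L\ne\emptyset$; the set of $x\in S$ with $N(x)\cap L_1\ne\emptyset$, $N(x)\cap L_2\neq\emptyset$ and $N(x)\cap R=\emptyset$, if $\tau_-=join(X;L_1,L_2)$ and $L\neq\emptyset$; and $\emptyset$ otherwise. Let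 $XR(Q)$ be the set of $x\in S$ with $N(x)\subseteq R\cup X$, $v\in N(x)$ and $N(x)\cap R\ne\emptyset$, if $\tau_+=forget(v)$; and $\emptyset$ otherwise. Let $\epsilon(Q)=1$ if $N(x)=X$ for some $x\in S$, and $\epsilon(Q)=0$ otherwise. Put $$loctw(Q)=|X|+\max\{|XTR(Q)|+|XL(Q)|,\ |XTR(Q)|+|XR(Q)|,\ \epsilon(Q)\}-1 .$$ **Partial treewidth.** For a valid quintuple $Q=(\tau_-,L,X,R,\tau_+)$, $ptw(Q)$ is defined recursively, all minima being over valid quintuples of the indicated form (with arbitrary first entry): * $ptw(Q)=loctw(Q)$ if $Q$ is degenerate; * $ptw(Q)=\max\{loctw(Q),\min ptw(\cdot,L,X\setminus\{u\},R\cup\{u\},introduce(u))\}$ if $\tau_-=introduce(u)$; * $ptw(Q)=\max\{loctw(Q),\min ptw(\cdot,L\setminus\{u\},X\cup\{u\},R,forget(u))\}$ if $\tau_-=forget(u)$; * $ptw(Q)=\max\{loctw(Q),\min ptw(\cdot,L_1,X,R\cup L_2,\tau_-),\min ptw(\cdot,L_2,X,R\cup L_1,\tau_-)\}$ if $\tau_-=join(X;L_1,L_2)$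 (in the last three cases $L\neq\emptyset$). **Theorem.** The treewidth of $G$ is $$tw(G)=\min_{Q_{last}} ptw(Q_{last}),$$ where the minimum is over all valid quintuples $Q_{last}$ of the form $(\tau_-,\,C\setminus\{univ\},\,\{univ\},\,\emptyset,\,forget(univ))$; in particular such quintuples exist and the minimum is attained. -/

import Mathlib

namespace VCTreewidth

/-! ### Tree decompositions and treewidth -/

/-- A tree decomposition of `G`: a finite tree `T` on an index type `I`, with a bag for each node. -/
structure TreeDecomp {V : Type*} (G : SimpleGraph V) where
  I : Type
  [fintypeI : Fintype I]
  T : SimpleGraph I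
  isTree : T.IsTree
  bag : I → Finset V
  cover : ∀ v : V, ∃ i, v ∈ bag i
  edge : ∀ u v : V, G.Adj u v → ∃ i, u ∈ bag i ∧ v ∈ bag i
  connected : ∀ v : V, (T.induce {i | v ∈ bag i}).Connected

attribute [instance] TreeDecomp.fintypeI

/-- The width: the maximum size of a bag, minus one. -/
def TreeDecomp.width {V : Type*} {G : SimpleGraph V} (D : TreeDecomp G) : ℤ :=
  ((Finset.univ.sup fun i => (D.bag i).card : ℕ) : ℤ) - 1

/-- The treewidth: the minimum width of a tree decomposition. For a finite graph this is the infimum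
of a nonempty set of integers that is bounded below by `-1`. -/
noncomputable def treewidth {V : Type*} (G : SimpleGraph V) : ℤ :=
  sInf {w : ℤ | ∃ D : TreeDecomp G, D.width = w}

/-! ### Rooted tree decompositions, lower sets and traces -/

/-- A tree decomposition with an arbitrarily chosen root. -/
structure RootedTreeDecomp {V : Type*} (G : SimpleGraph V) extends TreeDecomp G where
  root : I

/-- The operations `introduce(u)`, `forget(u)` and `join(X; L₁, L₂)`. -/
inductive Op (V : Type*) where
  | introduce (u : V) : Op V
  | forget (u : V) : Op V
  | join (X L₁ L₂ : Finset V) : Op V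

/-- The operation that is left on `C` by an operation on the whole graph. -/
def Op.trace {V : Type*} [DecidableEq V] (C : Finset V) : Op V → Op V
  | .introduce u => .introduce u
  | .forget u => .forget u
  | .join X L₁ L₂ => .join (X ∩ C) (L₁ ∩ C) (L₂ ∩ C)

namespace RootedTreeDecomp

variable {V : Type*} [Fintype V] [DecidableEq V] {G : SimpleGraph V}

/-- `D.Father p i`: the node `p` is the father of the node `i`. -/
def Father (D : RootedTreeDecomp G) (p i : D.I) : Prop :=
  D.T.Adj p i ∧ D.T.dist D.root i = D.T.dist D.root p + 1

/-- `D.Above i j`: the node `j` belongs to the subtree rooted in `i` (possibly `j = i`). -/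
def Above (D : RootedTreeDecomp G) : D.I → D.I → Prop :=
  Relation.ReflTransGen D.Father

open scoped Classical in
/-- The union `V_i` of the bags of the subtree rooted in `i`. -/
noncomputable def below (D : RootedTreeDecomp G) (i : D.I) : Finset V :=
  Finset.univ.filter fun v => ∃ j, D.Above i j ∧ v ∈ D.bag j

/-- `L_i = V_i \ X_i`. -/
noncomputable def lower (D : RootedTreeDecomp G) (i : D.I) : Finset V :=
  D.below i \ D.bag i

/-- `R_i = V \ V_i`. -/
noncomputable def rest (D : RootedTreeDecomp G) (i : D.I) : Finset V :=
  Finset.univ \ D.below i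

/-- The trace of the node `i` on `C` is `(L, X, R)`. -/
def HasTrace (D : RootedTreeDecomp G) (C : Finset V) (i : D.I) (L X R : Finset V) : Prop :=
  D.lower i ∩ C = L ∧ D.bag i ∩ C = X ∧ D.rest i ∩ C = R

/-- `D.HasOp i τ`: the node `i` is one of the four types of nodes of a nice tree decomposition, and
`τ` is the operation associated to it. A leaf with bag `{u}` gets the operation `introduce(u)`. The
two children of a join node are not ordered, so the parameters `L₁`, `L₂` of a join may be listed in
both orders. -/
def HasOp (D : RootedTreeDecomp G) (i : D.I) : Op V → Prop
  | .introduce u =>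
      ((∀ j, ¬ D.Father i j) ∧ D.bag i = {u}) ∨
      ∃ j, (∀ j', D.Father i j' ↔ j' = j) ∧ u ∉ D.bag j ∧ D.bag i = insert u (D.bag j)
  | .forget u =>
      ∃ j, (∀ j', D.Father i j' ↔ j' = j) ∧ u ∈ D.bag j ∧ D.bag i = (D.bag j).erase u
  | .join X L₁ L₂ =>
      ∃ j k, j ≠ k ∧ (∀ j', D.Father i j' ↔ j' = j ∨ j' = k) ∧
        D.bag j = D.bag i ∧ D.bag k = D.bag i ∧
        X = D.bag i ∧ L₁ = D.lower j ∧ L₂ = D.lower k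

/-- Nice tree decompositions whose root bag is `{univ}`. -/
def IsNice (D : RootedTreeDecomp G) (univ : V) : Prop :=
  D.bag D.root = {univ} ∧ ∀ i, ∃ τ, D.HasOp i τ

end RootedTreeDecomp

/-! ### Valid partitions and valid quintuples -/

section

variable {V : Type*} [Fintype V] [DecidableEq V]

/-- `(L, X, R)` is the trace on `C` of some node of some tree decomposition of `G`. -/
def IsValidPartition (G : SimpleGraph V) (C L X R : Finset V) : Prop :=
  ∃ (D : RootedTreeDecomp G) (i : D.I), D.HasTrace C i L X R

/-- A quintuple `(τ₋, L, X, R, τ₊)`. -/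
structure Quintuple (V : Type*) where
  lo : Op V
  L : Finset V
  X : Finset V
  R : Finset V
  hi : Op V

/-- The nice tree decomposition `D` respects the quintuple `Q`: some node leaves the trace
`(L, X, R)` on `C`, with lowest such node `imin` and highest such node `imax`; on `C`, the operation
of `imin` is `τ₋` and the operation of the father of `imax` is `τ₊`. If `imax` is the root, then
`τ₊` is the operation that forgets the unique vertex of the root bag. -/
def Respects {G : SimpleGraph V} (C : Finset V) (D : RootedTreeDecomp G) (Q : Quintuple V) : Prop :=
  ∃ imin imax : D.I,
    D.HasTrace C imin Q.L Q.X Q.R ∧ D.HasTrace C imax Q.L Q.X Q.R ∧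
    (∀ i, D.HasTrace C i Q.L Q.X Q.R → D.Above imax i ∧ D.Above i imin) ∧
    (∃ τ, D.HasOp imin τ ∧ τ.trace C = Q.lo) ∧
    ((imax = D.root ∧ ∃ r, D.bag D.root = {r} ∧ Q.hi = .forget r) ∨
      ∃ p τ, D.Father p imax ∧ D.HasOp p τ ∧ τ.trace C = Q.hi)

/-- Degenerate valid quintuples: `L = ∅` and `τ₊ = forget(u)`, where `u ∈ X` has all its neighbours
in `C` inside `X`. The operation `τ₋` is irrelevant. -/
def IsDegenerate (G : SimpleGraph V) (C : Finset V) (Q : Quintuple V) : Prop :=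
  Q.L = ∅ ∧ IsValidPartition G C Q.L Q.X Q.R ∧
    ∃ u ∈ Q.X, Q.hi = .forget u ∧ ∀ w ∈ C, G.Adj u w → w ∈ Q.X

/-- Valid quintuples, including the degenerate ones. -/
def IsValid (G : SimpleGraph V) (univ : V) (C : Finset V) (Q : Quintuple V) : Prop :=
  (Q.L.Nonempty ∧ IsValidPartition G C Q.L Q.X Q.R ∧
    ∃ D : RootedTreeDecomp G, D.IsNice univ ∧ Respects C D Q) ∨
  IsDegenerate G C Q

/-! ### Local and partial treewidth -/

open scoped Classical in
/-- The vertices outside `C` with a neighbour in `L` and a neighbour in `R`. -/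
noncomputable def XTR (G : SimpleGraph V) (C : Finset V) (Q : Quintuple V) : Finset V :=
  Finset.univ.filter fun x => x ∉ C ∧ (∃ w ∈ Q.L, G.Adj x w) ∧ (∃ w ∈ Q.R, G.Adj x w)

open scoped Classical in
/-- The set `XL`, defined according to the type of `τ₋`; it is empty if `τ₋` is a forget operation
or if `L = ∅` (the degenerate case). -/
noncomputable def XL (G : SimpleGraph V) (C : Finset V) (Q : Quintuple V) : Finset V :=
  if Q.L = ∅ then ∅ else
    match Q.lo with
    | .introduce u => Finset.univ.filter fun x => x ∉ C ∧
        (∀ w, G.Adj x w → w ∈ Q.L ∪ Q.X) ∧ G.Adj x u ∧ ∃ w ∈ Q.L, G.Adj x w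
    | .forget _ => ∅
    | .join _ L₁ L₂ => Finset.univ.filter fun x => x ∉ C ∧
        (∃ w ∈ L₁, G.Adj x w) ∧ (∃ w ∈ L₂, G.Adj x w) ∧ ∀ w ∈ Q.R, ¬ G.Adj x w

open scoped Classical in
/-- The set `XR`, defined according to the type of `τ₊`. -/
noncomputable def XR (G : SimpleGraph V) (C : Finset V) (Q : Quintuple V) : Finset V :=
  match Q.hi with
  | .introduce _ => ∅
  | .forget v => Finset.univ.filter fun x => x ∉ C ∧
      (∀ w, G.Adj x w → w ∈ Q.R ∪ Q.X) ∧ G.Adj x v ∧ ∃ w ∈ Q.R, G.Adj x w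
  | .join _ _ _ => ∅

open scoped Classical in
/-- `ε(Q)` is `1` if some vertex outside `C` has neighbourhood exactly `X`, and `0` otherwise. -/
noncomputable def eps (G : SimpleGraph V) (C : Finset V) (Q : Quintuple V) : ℤ :=
  if ∃ x, x ∉ C ∧ ∀ w, G.Adj x w ↔ w ∈ Q.X then 1 else 0

/-- The local treewidth of a quintuple. -/
noncomputable def loctw (G : SimpleGraph V) (C : Finset V) (Q : Quintuple V) : ℤ :=
  (Q.X.card : ℤ) +
    max (max (((XTR G C Q).card : ℤ) + (XL G C Q).card) (((XTR G C Q).card : ℤ) + (XR G C Q).card))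
      (eps G C Q) - 1

/-- The partial treewidth of a valid quintuple, by recursion on `(|L|, |X|)`. The minima are taken in
`WithTop ℤ`, where the minimum of an empty set is `⊤`. The side conditions `u ∈ X`, `u ∈ L` and
`|L₁|, |L₂| < |L|` hold for every valid quintuple; they make the recursion terminate on the other
ones, where the value is irrelevant. -/
noncomputable def ptw (G : SimpleGraph V) (univ : V) (C : Finset V) (Q : Quintuple V) :
    WithTop ℤ :=
  if Q.L = ∅ then (loctw G C Q : WithTop ℤ) else
    match Q.lo with
    | .introduce u =>
        if _h : u ∈ Q.X then
          max (loctw G C Q : WithTop ℤ)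
            (sInf {t | ∃ τ : Op V,
              IsValid G univ C ⟨τ, Q.L, Q.X \ {u}, Q.R ∪ {u}, .introduce u⟩ ∧
              t = ptw G univ C ⟨τ, Q.L, Q.X \ {u}, Q.R ∪ {u}, .introduce u⟩})
        else ⊤
    | .forget u =>
        if _h : u ∈ Q.L then
          max (loctw G C Q : WithTop ℤ)
            (sInf {t | ∃ τ : Op V,
              IsValid G univ C ⟨τ, Q.L \ {u}, Q.X ∪ {u}, Q.R, .forget u⟩ ∧
              t = ptw G univ C ⟨τ, Q.L \ {u}, Q.X ∪ {u}, Q.R, .forget u⟩})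
        else ⊤
    | .join _ L₁ L₂ =>
        if _h : L₁.card < Q.L.card ∧ L₂.card < Q.L.card then
          max (loctw G C Q : WithTop ℤ) (max
            (sInf {t | ∃ τ : Op V,
              IsValid G univ C ⟨τ, L₁, Q.X, Q.R ∪ L₂, .join Q.X L₁ L₂⟩ ∧
              t = ptw G univ C ⟨τ, L₁, Q.X, Q.R ∪ L₂, .join Q.X L₁ L₂⟩})
            (sInf {t | ∃ τ : Op V,
              IsValid G univ C ⟨τ, L₂, Q.X, Q.R ∪ L₁, .join Q.X L₁ L₂⟩ ∧
              t = ptw G univ C ⟨τ, L₂, Q.X, Q.R ∪ L₁, .join Q.X L₁ L₂⟩}))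
        else ⊤
  termination_by (Q.L.card, Q.X.card)
  decreasing_by
    · exact Prod.Lex.right _ (Finset.card_lt_card
        (Finset.sdiff_ssubset (Finset.singleton_subset_iff.2 _h) (Finset.singleton_nonempty u)))
    · exact Prod.Lex.left _ _ (Finset.card_lt_card
        (Finset.sdiff_ssubset (Finset.singleton_subset_iff.2 _h) (Finset.singleton_nonempty u)))
    · exact Prod.Lex.left _ _ _h.1
    · exact Prod.Lex.left _ _ _h.2

end

end VCTreewidth

/-! The statement is proved in the form `treewidth_le_iff`: for every integer `k`, the treewidth is
at most `k` iff some valid last quintuple has `ptw` at most `k`, that is, iff `Feasible` holds at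
the root.

From decompositions to quintuples: a tree decomposition is made nice with root bag `{univ}`, without
enlarging its bags (`TreeDecomp.exists_isNice`). The nodes with a given trace having `L ≠ ∅` form a
vertical path. The operation at its lowest node changes the trace, so each child of that node is the
highest node of its own trace; following the recursion of `ptw` thus means walking down the tree
(`feasible`). Along the way `loctw ≤ k`, because `X ∪ XTR ∪ XL` lies in the bag of the lowest node,
`X ∪ XTR ∪ XR` in that of the highest one, and a vertex with neighbourhood `X` shares some bag with
all of `X` (`loctw_le`).

From quintuples to decompositions: the recursion of `ptw` is read as a building plan
(`exists_realizes`). The pieces get root bag `bagHi`; introductions and joins also create `bagLo`.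
Vertices outside `C` have all their neighbours in `C`, so their place is forced up to leaves: such a
vertex enters a bag when its neighbours are split between two sides, and otherwise, once a neighbour
is forgotten while all the others are still in the bag, it is attached as a leaf with its
neighbourhood. The term `ε` pays for such a leaf when the neighbourhood is all of `X`; a smaller
neighbourhood leaves room for the vertex. Validity enters here only through the fact that `X`
separates `L` from `R`. -/

set_option linter.unusedSectionVars false

namespace VCTreewidth

/-! ### Ancestors, subtrees and separation in a rooted tree decomposition. -/

namespace RootedTreeDecomp

section Tree

variable {V : Type*} {G : SimpleGraph V} (D : RootedTreeDecomp G)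

/-- The distance of a node from the root. -/
noncomputable def depth (i : D.I) : ℕ := D.T.dist D.root i

variable {D}

theorem Father.depth_eq {p i : D.I} (h : D.Father p i) : D.depth i = D.depth p + 1 := h.2

/-- A shortest walk from the root to a father, prolonged by one edge, is a path to `i`; paths in a
tree are unique, and the father is the penultimate node. -/
theorem Father.unique {p q i : D.I} (hp : D.Father p i) (hq : D.Father q i) : p = q := by
  have key : ∀ {r : D.I}, D.Father r i → ∃ P : D.T.Walk D.root i, P.IsPath ∧ P.penultimate = r := by
    intro r hr
    obtain ⟨P, hP⟩ := D.isTree.connected.exists_walk_length_eq_dist D.root r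
    refine ⟨P.concat hr.1, SimpleGraph.Walk.isPath_of_length_eq_dist _ ?_, by simp⟩
    rw [SimpleGraph.Walk.length_concat, hP, hr.2]
  obtain ⟨P, hP, rfl⟩ := key hp
  obtain ⟨Q, hQ, rfl⟩ := key hq
  rw [(D.isTree.existsUnique_path D.root i).unique hP hQ]

theorem father_or_father_of_adj {a b : D.I} (h : D.T.Adj a b) : D.Father a b ∨ D.Father b a := by
  rcases D.isTree.dist_eq_dist_add_one_of_adj D.root h with h' | h'
  · exact Or.inr ⟨h.symm, h'⟩
  · exact Or.inl ⟨h, h'⟩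

theorem exists_father {i : D.I} (hi : i ≠ D.root) : ∃ p, D.Father p i := by
  obtain ⟨P, hP⟩ := D.isTree.connected.exists_walk_length_eq_dist D.root i
  have hn : ¬ P.Nil := SimpleGraph.Walk.not_nil_of_ne hi.symm
  refine ⟨P.penultimate, P.adj_penultimate hn, ?_⟩
  have h1 : D.T.dist D.root P.penultimate ≤ P.length - 1 := by
    simpa using SimpleGraph.dist_le P.dropLast
  have h2 : 0 < P.length := by
    rw [Nat.pos_iff_ne_zero]
    exact fun h => hn (SimpleGraph.Walk.length_eq_zero_iff.1 h)
  rcases D.isTree.dist_eq_dist_add_one_of_adj D.root (P.adj_penultimate hn) with h' | h' <;> omega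

theorem depth_root : D.depth D.root = 0 := by simp [depth]

theorem not_father_root {p : D.I} : ¬ D.Father p D.root := fun h => by
  have := h.depth_eq
  rw [depth_root] at this
  omega

theorem Above.refl (i : D.I) : D.Above i i := Relation.ReflTransGen.refl

theorem Above.trans {a b c : D.I} (h : D.Above a b) (h' : D.Above b c) : D.Above a c :=
  Relation.ReflTransGen.trans h h'

theorem Father.above {p i : D.I} (h : D.Father p i) : D.Above p i := Relation.ReflTransGen.single h

theorem above_root (i : D.I) : D.Above D.root i := by
  induction h : D.depth i using Nat.strong_induction_on generalizing i with
  | _ n ih =>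
    by_cases hi : i = D.root
    · rw [hi]; exact Above.refl _
    · obtain ⟨p, hp⟩ := exists_father hi
      exact (ih (D.depth p) (by have := hp.depth_eq; omega) p rfl).trans hp.above

theorem Above.eq_or_depth_lt {a b : D.I} (h : D.Above a b) : a = b ∨ D.depth a < D.depth b := by
  unfold Above at h
  induction h with
  | refl => exact Or.inl rfl
  | tail _ h' ih =>
    have := h'.depth_eq
    rcases ih with rfl | ih <;> right <;> omega

theorem Above.antisymm {a b : D.I} (h : D.Above a b) (h' : D.Above b a) : a = b := by
  rcases h.eq_or_depth_lt with h1 | h1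
  · exact h1
  · rcases h'.eq_or_depth_lt with h2 | h2
    · exact h2.symm
    · omega

theorem Above.eq_or_above_father {a p i : D.I} (h : D.Above a i) (hp : D.Father p i) :
    a = i ∨ D.Above a p := by
  rcases Relation.ReflTransGen.cases_tail h with h | ⟨c, hc, hci⟩
  · exact Or.inl h.symm
  · rw [hp.unique hci]; exact Or.inr hc

theorem Above.eq_or_exists_child {a b : D.I} (h : D.Above a b) :
    a = b ∨ ∃ c, D.Father a c ∧ D.Above c b :=
  Relation.ReflTransGen.cases_head h

theorem Above.total {a b c : D.I} (h : D.Above a c) (h' : D.Above b c) :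
    D.Above a b ∨ D.Above b a := by
  unfold Above at h
  induction h with
  | refl => exact Or.inr h'
  | tail hab hf ih =>
    rcases h'.eq_or_above_father hf with rfl | h'
    · exact Or.inl (hab.tail hf)
    · exact ih h'

theorem Father.not_above {p i : D.I} (h : D.Father p i) : ¬ D.Above i p := fun h' => by
  have := h.depth_eq
  rcases h'.eq_or_depth_lt with rfl | h' <;> omega

theorem eq_and_father_of_adj {i c d : D.I} (h : D.T.Adj c d) (hc : D.Above i c)
    (hd : ¬ D.Above i d) : c = i ∧ D.Father d i := by
  rcases father_or_father_of_adj h with h | h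
  · exact (hd (hc.trans h.above)).elim
  · rcases hc.eq_or_above_father h with rfl | h'
    · exact ⟨rfl, h⟩
    · exact (hd h').elim

/-- A vertex with bags inside and outside the subtree of `i` belongs to the bags of `i` and of its
father. -/
theorem separation {i a b : D.I} {v : V} (ha : v ∈ D.bag a) (hb : v ∈ D.bag b) (hia : D.Above i a)
    (hib : ¬ D.Above i b) : v ∈ D.bag i ∧ ∃ p, D.Father p i ∧ v ∈ D.bag p := by
  obtain ⟨P⟩ := (D.connected v).preconnected ⟨a, ha⟩ ⟨b, hb⟩
  -- A walk through bags containing `v` leaves the subtree of `i`, and the only edge out of that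
  -- subtree goes from `i` to its father.
  obtain ⟨d, -, h1, h2⟩ := P.exists_boundary_dart {x | D.Above i x.1} hia hib
  obtain ⟨h3, h4⟩ := eq_and_father_of_adj (i := i) (c := d.fst.1) (d := d.snd.1) d.adj h1 h2
  exact ⟨h3 ▸ d.fst.2, _, h4, d.snd.2⟩

theorem wellFounded_child : WellFounded fun j i => D.Father i j := by
  have : IsTrans D.I fun a b => D.depth b < D.depth a := ⟨fun _ _ _ h h' => h'.trans h⟩
  have : Std.Irrefl fun a b : D.I => D.depth b < D.depth a := ⟨fun _ => lt_irrefl _⟩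
  refine Subrelation.wf (r := fun a b => D.depth b < D.depth a) ?_
    (Finite.wellFounded_of_trans_of_irrefl _)
  intro j i h
  have := h.depth_eq
  show D.depth i < D.depth j
  omega

theorem not_above_of_fathers {i j k : D.I} (hj : D.Father i j) (hk : D.Father i k) (hjk : j ≠ k) :
    ¬ D.Above j k := fun h => by
  rcases h.eq_or_above_father hk with h | h
  · exact hjk h
  · exact hj.not_above h

/-- A vertex below two different children of `i` belongs to the bag of `i`. -/
theorem mem_bag_of_siblings {i j k a b : D.I} {v : V} (hj : D.Father i j) (hk : D.Father i k)
    (hjk : j ≠ k) (ha : D.Above j a) (hb : D.Above k b) (hva : v ∈ D.bag a) (hvb : v ∈ D.bag b) :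
    v ∈ D.bag i := by
  have hjb : ¬ D.Above j b := fun h => by
    rcases h.total hb with h | h
    · exact not_above_of_fathers hj hk hjk h
    · exact not_above_of_fathers hk hj hjk.symm h
  obtain ⟨-, p, hp, hvp⟩ := separation hva hvb ha hjb
  rwa [hj.unique hp]

end Tree

section Below

variable {V : Type*} [Fintype V] [DecidableEq V] {G : SimpleGraph V} {D : RootedTreeDecomp G}

theorem mem_below {i : D.I} {v : V} : v ∈ D.below i ↔ ∃ j, D.Above i j ∧ v ∈ D.bag j := by
  simp [below]

theorem mem_lower {i : D.I} {v : V} : v ∈ D.lower i ↔ v ∈ D.below i ∧ v ∉ D.bag i := by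
  simp [lower]

theorem mem_rest {i : D.I} {v : V} : v ∈ D.rest i ↔ v ∉ D.below i := by
  simp [rest]

theorem bag_subset_below (i : D.I) : D.bag i ⊆ D.below i := fun _ hv =>
  mem_below.2 ⟨i, Above.refl i, hv⟩

theorem Above.below_subset {i j : D.I} (h : D.Above i j) : D.below j ⊆ D.below i := fun _ hv => by
  obtain ⟨k, hk, hv⟩ := mem_below.1 hv
  exact mem_below.2 ⟨k, h.trans hk, hv⟩

/-- A vertex is below `i` iff it is in the bag of `i` or below one of the children. -/
theorem mem_below_iff {i : D.I} {v : V} :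
    v ∈ D.below i ↔ v ∈ D.bag i ∨ ∃ j, D.Father i j ∧ v ∈ D.below j := by
  constructor
  · intro hv
    obtain ⟨k, hk, hv⟩ := mem_below.1 hv
    rcases hk.eq_or_exists_child with rfl | ⟨c, hc, hck⟩
    · exact Or.inl hv
    · exact Or.inr ⟨c, hc, mem_below.2 ⟨k, hck, hv⟩⟩
  · rintro (hv | ⟨j, hj, hv⟩)
    · exact bag_subset_below i hv
    · exact hj.above.below_subset hv

theorem mem_bag_of_mem_below {i b : D.I} {v : V} (hv : v ∈ D.below i) (hb : v ∈ D.bag b)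
    (hib : ¬ D.Above i b) : v ∈ D.bag i := by
  obtain ⟨a, ha, hva⟩ := mem_below.1 hv
  exact (separation hva hb ha hib).1

theorem above_of_mem_lower {i b : D.I} {v : V} (hv : v ∈ D.lower i) (hb : v ∈ D.bag b) :
    D.Above i b := by
  by_contra h
  exact (mem_lower.1 hv).2 (mem_bag_of_mem_below (mem_lower.1 hv).1 hb h)

/-- All bags of a vertex in `lower j` are below `j`, so it can be in the bag of `i` only if `i = j`.
-/
theorem Above.lower_subset {i j : D.I} (h : D.Above i j) : D.lower j ⊆ D.lower i := fun v hv => by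
  refine mem_lower.2 ⟨h.below_subset (mem_lower.1 hv).1, fun hi => ?_⟩
  have := h.antisymm (above_of_mem_lower hv hi)
  subst this
  exact (mem_lower.1 hv).2 hi

theorem Father.mem_bag_of_mem_below {p i : D.I} (h : D.Father p i) {v : V} (hv : v ∈ D.below i)
    (hp : v ∈ D.bag p) : v ∈ D.bag i :=
  RootedTreeDecomp.mem_bag_of_mem_below hv hp h.not_above

/-- There is no edge between the lower set and the rest. -/
theorem not_adj_of_lower_of_rest {i : D.I} {u v : V} (hu : u ∈ D.lower i) (hv : v ∈ D.rest i) :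
    ¬ G.Adj u v := fun h => by
  obtain ⟨a, ha, hb⟩ := D.edge u v h
  exact mem_rest.1 hv (mem_below.2 ⟨a, above_of_mem_lower hu ha, hb⟩)

end Below

end RootedTreeDecomp

end VCTreewidth

/-! ### Rooted trees given by a parent function. -/

namespace VCTreewidth

section ParentFunction

variable {I : Type*} (par : I → Option I)

/-- The graph in which every node is adjacent to its parent. -/
def parentGraph (depth : I → ℕ) (h : ∀ i p, par i = some p → depth i = depth p + 1) :
    SimpleGraph I where
  Adj i j := par i = some j ∨ par j = some i
  symm := ⟨fun _ _ h => h.symm⟩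
  loopless := ⟨fun i hi => by
    have h' : par i = some i := by tauto
    have := h i i h'
    omega⟩

variable {par} {depth : I → ℕ} (h : ∀ i p, par i = some p → depth i = depth p + 1) {root : I}
  (hroot : ∀ i, par i = none → i = root)

include h hroot in
/-- Induction along a parent function. -/
theorem parent_induction {P : I → Prop} (h0 : P root)
    (hs : ∀ i p, par i = some p → P p → P i) (i : I) : P i := by
  induction hn : depth i using Nat.strong_induction_on generalizing i with
  | _ n ih =>
    cases hp : par i with
    | none => rw [hroot i hp]; exact h0
    | some p => exact hs i p hp (ih (depth p) (by have := h i p hp; omega) p rfl)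

theorem parentGraph_connected (hroot : ∀ i, par i = none → i = root) :
    (parentGraph par depth h).Connected := by
  have key : ∀ i, (parentGraph par depth h).Reachable root i := by
    refine parent_induction h hroot (SimpleGraph.Reachable.refl _) fun i p hp hr => hr.trans ?_
    exact SimpleGraph.Adj.reachable (Or.inr hp)
  exact { preconnected := fun i j => (key i).symm.trans (key j), nonempty := ⟨root⟩ }

theorem parentGraph_isTree [Finite I] (hroot : ∀ i, par i = none → i = root)
    (hr : par root = none) : (parentGraph par depth h).IsTree := by
  classical
  have := Fintype.ofFinite I
  rw [SimpleGraph.isTree_iff_connected_and_card]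
  have hc := parentGraph_connected h hroot
  refine ⟨hc, le_antisymm ?_ hc.card_vert_le_card_edgeSet_add_one⟩
  -- Every edge joins a node other than the root to its parent, which bounds the number of edges by
  -- the number of nodes minus one. The default value in `getD` would matter only at the root, which
  -- is erased.
  have hsub : (parentGraph par depth h).edgeSet ⊆
      ((Finset.univ.erase root).image fun i => s(i, (par i).getD i) : Finset (Sym2 I)) := by
    intro e
    induction e with
    | _ i j =>
      have : ∀ i j, par i = some j → i ≠ root ∧ s(i, (par i).getD i) = s(i, j) := by
        intro i j hij
        refine ⟨?_, by rw [hij]; rfl⟩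
        rintro rfl
        rw [hr] at hij
        cases hij
      rintro (hij | hij)
      · rw [Finset.mem_coe, Finset.mem_image]
        exact ⟨i, Finset.mem_erase.2 ⟨(this i j hij).1, Finset.mem_univ _⟩, (this i j hij).2⟩
      · rw [Finset.mem_coe, Finset.mem_image]
        exact ⟨j, Finset.mem_erase.2 ⟨(this j i hij).1, Finset.mem_univ _⟩,
          (this j i hij).2.trans Sym2.eq_swap⟩
  have h1 := Set.ncard_le_ncard hsub (Finset.finite_toSet _)
  rw [Set.ncard_coe_finset] at h1
  have h2 := Finset.card_image_le (s := Finset.univ.erase root)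
    (f := fun i => s(i, (par i).getD i))
  rw [Finset.card_erase_of_mem (Finset.mem_univ _), Finset.card_univ] at h2
  have h3 : 0 < Fintype.card I := Fintype.card_pos_iff.2 ⟨root⟩
  rw [Nat.card_coe_set_eq, Nat.card_eq_fintype_card]
  omega

theorem parentGraph_dist (hroot : ∀ i, par i = none → i = root) (h0 : depth root = 0) (i : I) :
    (parentGraph par depth h).dist root i = depth i := by
  refine le_antisymm ?_ ?_
  · revert i
    refine parent_induction h hroot (by simp [h0]) fun i p hp hd => ?_
    have hadj : (parentGraph par depth h).Adj p i := Or.inr hp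
    have := (parentGraph_connected h hroot).dist_triangle (u := root) (v := p) (w := i)
    rw [SimpleGraph.dist_eq_one_iff_adj.2 hadj] at this
    have := h i p hp
    omega
  · obtain ⟨P, hP⟩ := (parentGraph_connected h hroot).exists_walk_length_eq_dist root i
    rw [← hP]
    -- The depth changes by exactly one along each edge, so a walk is at least as long as the gain
    -- in depth.
    have key : ∀ (a b : I) (Q : (parentGraph par depth h).Walk a b),
        depth b ≤ Q.length + depth a := by
      intro a b Q
      induction Q with
      | nil => simp
      | cons hab _ ih =>
        rw [SimpleGraph.Walk.length_cons]
        rcases hab with hab | hab <;> have := h _ _ hab <;> omega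
    have := key _ _ P
    omega

/-- A set of nodes closed under taking parents, down to a single top node, is connected. -/
theorem parentGraph_induce_connected {s : Set I} {a : I} (ha : a ∈ s)
    (hs : ∀ i ∈ s, i = a ∨ ∃ p, par i = some p ∧ p ∈ s) :
    ((parentGraph par depth h).induce s).Connected := by
  have key : ∀ (i : I) (hi : i ∈ s),
      ((parentGraph par depth h).induce s).Reachable ⟨i, hi⟩ ⟨a, ha⟩ := by
    intro i
    induction hn : depth i using Nat.strong_induction_on generalizing i with
    | _ n ih =>
      intro hi
      rcases hs i hi with rfl | ⟨p, hp, hps⟩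
      · exact SimpleGraph.Reachable.refl _
      · refine SimpleGraph.Reachable.trans (SimpleGraph.Adj.reachable ?_)
          (ih (depth p) (by have := h i p hp; omega) p rfl hps)
        exact Or.inl hp
  exact { preconnected := fun i j => (key i.1 i.2).trans (key j.1 j.2).symm, nonempty := ⟨⟨a, ha⟩⟩ }

end ParentFunction

/-! ### Bag trees, and the rooted tree decompositions that they define. -/

/-- Rooted binary trees with a bag at each node. -/
inductive BagTree (V : Type*) where
  | leaf (b : Finset V) : BagTree V
  | un (b : Finset V) (t : BagTree V) : BagTree V
  | bin (b : Finset V) (t₁ t₂ : BagTree V) : BagTree V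

namespace BagTree

variable {V : Type*}

/-- The nodes of a bag tree. -/
@[reducible] def Node : BagTree V → Type
  | leaf _ => Unit
  | un _ t => Option t.Node
  | bin _ t₁ t₂ => Option (t₁.Node ⊕ t₂.Node)

noncomputable instance instFintypeNode : (t : BagTree V) → Fintype t.Node
  | leaf _ => inferInstanceAs (Fintype Unit)
  | un _ t => haveI := instFintypeNode t; inferInstanceAs (Fintype (Option t.Node))
  | bin _ t₁ t₂ =>
    haveI := instFintypeNode t₁
    haveI := instFintypeNode t₂
    inferInstanceAs (Fintype (Option (t₁.Node ⊕ t₂.Node)))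

/-- The root of a bag tree. -/
def root : (t : BagTree V) → t.Node
  | leaf _ => ()
  | un _ _ => none
  | bin _ _ _ => none

/-- The bag of the root. -/
def top : BagTree V → Finset V
  | leaf b => b
  | un b _ => b
  | bin b _ _ => b

/-- The parent of a node. -/
def parent : (t : BagTree V) → t.Node → Option t.Node
  | leaf _, _ => none
  | un _ _, none => none
  | un _ t, some i => some (t.parent i)
  | bin _ _ _, none => none
  | bin _ t₁ _, some (.inl i) => some ((t₁.parent i).map .inl)
  | bin _ _ t₂, some (.inr i) => some ((t₂.parent i).map .inr)

/-- The number of steps from a node to the root. -/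
def level : (t : BagTree V) → t.Node → ℕ
  | leaf _, _ => 0
  | un _ _, none => 0
  | un _ t, some i => t.level i + 1
  | bin _ _ _, none => 0
  | bin _ t₁ _, some (.inl i) => t₁.level i + 1
  | bin _ _ t₂, some (.inr i) => t₂.level i + 1

/-- The bag of a node. -/
def bagAt : (t : BagTree V) → t.Node → Finset V
  | leaf b, _ => b
  | un b _, none => b
  | un _ t, some i => t.bagAt i
  | bin b _ _, none => b
  | bin _ t₁ _, some (.inl i) => t₁.bagAt i
  | bin _ _ t₂, some (.inr i) => t₂.bagAt i

theorem parent_eq_none {t : BagTree V} {i : t.Node} : t.parent i = none ↔ i = t.root := by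
  cases t with
  | leaf b => simp [parent, root]
  | un b t => cases i <;> simp [parent, root]
  | bin b t₁ t₂ => rcases i with _ | i | i <;> simp [parent, root]

theorem level_root (t : BagTree V) : t.level t.root = 0 := by
  cases t <;> simp [level, root]

theorem bagAt_root (t : BagTree V) : t.bagAt t.root = t.top := by
  cases t <;> simp [bagAt, root, top]

theorem level_parent {t : BagTree V} : ∀ (i p : t.Node), t.parent i = some p →
    t.level i = t.level p + 1 := by
  induction t with
  | leaf b => intro i p h; simp [parent] at h
  | un b t ih =>
    rintro (_ | i) p h
    · simp [parent] at h
    · simp only [parent, Option.some.injEq] at h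
      subst h
      cases hp : t.parent i with
      | none => rw [parent_eq_none] at hp; subst hp; simp [level, level_root]
      | some p => simp [level, ih i p hp]
  | bin b t₁ t₂ ih₁ ih₂ =>
    rintro (_ | i | i) p h
    · simp [parent] at h
    · simp only [parent, Option.some.injEq] at h
      subst h
      cases hp : t₁.parent i with
      | none => rw [parent_eq_none] at hp; subst hp; simp [level, level_root]
      | some p => simp [level, ih₁ i p hp]
    · simp only [parent, Option.some.injEq] at h
      subst h
      cases hp : t₂.parent i with
      | none => rw [parent_eq_none] at hp; subst hp; simp [level, level_root]
      | some p => simp [level, ih₂ i p hp]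

/-- `t.HasBag b`: some node of `t` has the bag `b`. -/
def HasBag : BagTree V → Finset V → Prop
  | leaf b, c => c = b
  | un b t, c => c = b ∨ t.HasBag c
  | bin b t₁ t₂, c => c = b ∨ t₁.HasBag c ∨ t₂.HasBag c

theorem hasBag_iff {t : BagTree V} {c : Finset V} : t.HasBag c ↔ ∃ i, t.bagAt i = c := by
  induction t with
  | leaf b => simp [HasBag, bagAt, eq_comm]
  | un b t ih =>
    rw [HasBag, ih]
    constructor
    · rintro (rfl | ⟨i, rfl⟩)
      · exact ⟨none, rfl⟩
      · exact ⟨some i, rfl⟩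
    · rintro ⟨_ | i, rfl⟩
      · exact Or.inl rfl
      · exact Or.inr ⟨i, rfl⟩
  | bin b t₁ t₂ ih₁ ih₂ =>
    rw [HasBag, ih₁, ih₂]
    constructor
    · rintro (rfl | ⟨i, rfl⟩ | ⟨i, rfl⟩)
      · exact ⟨none, rfl⟩
      · exact ⟨some (.inl i), rfl⟩
      · exact ⟨some (.inr i), rfl⟩
    · rintro ⟨_ | i | i, rfl⟩
      · exact Or.inl rfl
      · exact Or.inr (Or.inl ⟨i, rfl⟩)
      · exact Or.inr (Or.inr ⟨i, rfl⟩)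

theorem hasBag_top (t : BagTree V) : t.HasBag t.top := hasBag_iff.2 ⟨_, t.bagAt_root⟩

/-- `t.Verts v`: the vertex `v` occurs in some bag. -/
def Verts (t : BagTree V) (v : V) : Prop := ∃ c, t.HasBag c ∧ v ∈ c

@[simp] theorem verts_leaf {b : Finset V} {v : V} : (leaf b).Verts v ↔ v ∈ b := by
  simp [Verts, HasBag]

@[simp] theorem verts_un {b : Finset V} {t : BagTree V} {v : V} :
    (un b t).Verts v ↔ v ∈ b ∨ t.Verts v := by
  simp [Verts, HasBag, or_and_right, exists_or]

@[simp] theorem verts_bin {b : Finset V} {t₁ t₂ : BagTree V} {v : V} :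
    (bin b t₁ t₂).Verts v ↔ v ∈ b ∨ t₁.Verts v ∨ t₂.Verts v := by
  simp [Verts, HasBag, or_and_right, exists_or]

theorem verts_of_mem_top {t : BagTree V} {v : V} (h : v ∈ t.top) : t.Verts v :=
  ⟨_, t.hasBag_top, h⟩

/-- Every vertex occurs in a connected set of bags. -/
def Conn : BagTree V → Prop
  | leaf _ => True
  | un b t => t.Conn ∧ ∀ v ∈ b, t.Verts v → v ∈ t.top
  | bin b t₁ t₂ => t₁.Conn ∧ t₂.Conn ∧ (∀ v ∈ b, t₁.Verts v → v ∈ t₁.top) ∧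
      (∀ v ∈ b, t₂.Verts v → v ∈ t₂.top) ∧ ∀ v, t₁.Verts v → t₂.Verts v → v ∈ b

/-- Under `Conn`, the bags containing a vertex have a top node. -/
theorem exists_top_node {t : BagTree V} (ht : t.Conn) {v : V} (hv : t.Verts v) :
    ∃ a, v ∈ t.bagAt a ∧ (v ∈ t.top → a = t.root) ∧
      ∀ i, v ∈ t.bagAt i → i = a ∨ ∃ p, t.parent i = some p ∧ v ∈ t.bagAt p := by
  induction t with
  | leaf b =>
    exact ⟨(), verts_leaf.1 hv, fun _ => rfl, fun _ _ => Or.inl rfl⟩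
  | un b t ih =>
    obtain ⟨h1, h2⟩ := ht
    by_cases hb : v ∈ b
    · refine ⟨none, hb, fun _ => rfl, ?_⟩
      rintro (_ | i) hi
      · exact Or.inl rfl
      · have hvt : t.Verts v := ⟨_, hasBag_iff.2 ⟨i, rfl⟩, hi⟩
        obtain ⟨a, -, hra, ha⟩ := ih h1 hvt
        -- Since `v` is in the new root bag, it is in the top bag of `t`; the top node of `v` in `t`
        -- is then the root of `t`, whose parent is the new root.
        have := hra (h2 v hb hvt)
        subst this
        rcases ha i hi with rfl | ⟨p, hp, hvp⟩
        · exact Or.inr ⟨none, by simp [parent, parent_eq_none.2 rfl], hb⟩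
        · exact Or.inr ⟨some p, by simp [parent, hp], hvp⟩
    · have hvt : t.Verts v := by simpa [hb] using hv
      obtain ⟨a, hva, -, ha⟩ := ih h1 hvt
      refine ⟨some a, hva, fun h => (hb h).elim, ?_⟩
      rintro (_ | i) hi
      · exact (hb hi).elim
      · rcases ha i hi with rfl | ⟨p, hp, hvp⟩
        · exact Or.inl rfl
        · exact Or.inr ⟨some p, by simp [parent, hp], hvp⟩
  | bin b t₁ t₂ ih₁ ih₂ =>
    obtain ⟨h1, h2, h3, h4, h5⟩ := ht
    by_cases hb : v ∈ b
    · refine ⟨none, hb, fun _ => rfl, ?_⟩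
      rintro (_ | i | i) hi
      · exact Or.inl rfl
      · have hvt : t₁.Verts v := ⟨_, hasBag_iff.2 ⟨i, rfl⟩, hi⟩
        obtain ⟨a, -, hra, ha⟩ := ih₁ h1 hvt
        have := hra (h3 v hb hvt)
        subst this
        rcases ha i hi with rfl | ⟨p, hp, hvp⟩
        · exact Or.inr ⟨none, by simp [parent, parent_eq_none.2 rfl], hb⟩
        · exact Or.inr ⟨some (.inl p), by simp [parent, hp], hvp⟩
      · have hvt : t₂.Verts v := ⟨_, hasBag_iff.2 ⟨i, rfl⟩, hi⟩
        obtain ⟨a, -, hra, ha⟩ := ih₂ h2 hvt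
        have := hra (h4 v hb hvt)
        subst this
        rcases ha i hi with rfl | ⟨p, hp, hvp⟩
        · exact Or.inr ⟨none, by simp [parent, parent_eq_none.2 rfl], hb⟩
        · exact Or.inr ⟨some (.inr p), by simp [parent, hp], hvp⟩
    · have hvt : t₁.Verts v ∨ t₂.Verts v := by simpa [hb] using hv
      rcases hvt with hvt | hvt
      · obtain ⟨a, hva, -, ha⟩ := ih₁ h1 hvt
        refine ⟨some (.inl a), hva, fun h => (hb h).elim, ?_⟩
        rintro (_ | i | i) hi
        · exact (hb hi).elim
        · rcases ha i hi with rfl | ⟨p, hp, hvp⟩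
          · exact Or.inl rfl
          · exact Or.inr ⟨some (.inl p), by simp [parent, hp], hvp⟩
        · exact (hb (h5 v hvt ⟨_, hasBag_iff.2 ⟨i, rfl⟩, hi⟩)).elim
      · obtain ⟨a, hva, -, ha⟩ := ih₂ h2 hvt
        refine ⟨some (.inr a), hva, fun h => (hb h).elim, ?_⟩
        rintro (_ | i | i) hi
        · exact (hb hi).elim
        · exact (hb (h5 v ⟨_, hasBag_iff.2 ⟨i, rfl⟩, hi⟩ hvt)).elim
        · rcases ha i hi with rfl | ⟨p, hp, hvp⟩
          · exact Or.inl rfl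
          · exact Or.inr ⟨some (.inr p), by simp [parent, hp], hvp⟩

/-- The tree decomposition given by a bag tree. -/
noncomputable def toRooted {G : SimpleGraph V} (t : BagTree V) (hc : t.Conn) (hv : ∀ v, t.Verts v)
    (he : ∀ u v, G.Adj u v → ∃ c, t.HasBag c ∧ u ∈ c ∧ v ∈ c) : RootedTreeDecomp G where
  I := t.Node
  T := parentGraph t.parent t.level level_parent
  isTree := parentGraph_isTree level_parent (fun _ => parent_eq_none.1) (parent_eq_none.2 rfl)
  bag := t.bagAt
  cover v := by
    obtain ⟨c, hc, h⟩ := hv v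
    obtain ⟨i, rfl⟩ := hasBag_iff.1 hc
    exact ⟨i, h⟩
  edge u v h := by
    obtain ⟨c, hc, h⟩ := he u v h
    obtain ⟨i, rfl⟩ := hasBag_iff.1 hc
    exact ⟨i, h⟩
  connected v := by
    obtain ⟨a, ha, -, h⟩ := exists_top_node hc (hv v)
    exact parentGraph_induce_connected level_parent ha h
  root := t.root

section toRooted

variable {G : SimpleGraph V} {t : BagTree V} {hc : t.Conn} {hv : ∀ v, t.Verts v}
  {he : ∀ u v, G.Adj u v → ∃ c, t.HasBag c ∧ u ∈ c ∧ v ∈ c}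

theorem toRooted_father {p i : t.Node} :
    (t.toRooted hc hv he).Father p i ↔ t.parent i = some p := by
  have hd : ∀ i, (parentGraph t.parent t.level level_parent).dist t.root i = t.level i :=
    parentGraph_dist level_parent (fun _ => parent_eq_none.1) t.level_root
  change ((t.parent p = some i ∨ t.parent i = some p) ∧
    (parentGraph t.parent t.level level_parent).dist t.root i =
      (parentGraph t.parent t.level level_parent).dist t.root p + 1) ↔ _
  rw [hd, hd]
  constructor
  · rintro ⟨h | h, h'⟩
    · have := level_parent _ _ h
      omega
    · exact h
  · exact fun h => ⟨Or.inr h, level_parent _ _ h⟩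

theorem toRooted_width_le {k : ℤ} (h : ∀ c, t.HasBag c → (c.card : ℤ) ≤ k + 1) :
    (t.toRooted hc hv he).width ≤ k := by
  have hk : (0 : ℤ) ≤ k + 1 := le_trans (by positivity) (h _ t.hasBag_top)
  obtain ⟨n, hn⟩ := Int.eq_ofNat_of_zero_le hk
  have : (Finset.univ.sup fun i => ((t.toRooted hc hv he).bag i).card) ≤ n := by
    refine Finset.sup_le fun i _ => ?_
    have := h (t.bagAt i) (hasBag_iff.2 ⟨i, rfl⟩)
    rw [hn] at this
    exact_mod_cast this
  unfold TreeDecomp.width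
  have h' : ((Finset.univ.sup fun i => ((t.toRooted hc hv he).bag i).card : ℕ) : ℤ) ≤ n := by
    exact_mod_cast this
  linarith

end toRooted

variable [DecidableEq V]

/-- The bag trees of nice tree decompositions. -/
def Nice : BagTree V → Prop
  | leaf b => ∃ u, b = {u}
  | un b t => t.Nice ∧ ((∃ u, u ∉ t.top ∧ b = insert u t.top) ∨ ∃ u ∈ t.top, b = t.top.erase u)
  | bin b t₁ t₂ => t₁.Nice ∧ t₂.Nice ∧ t₁.top = b ∧ t₂.top = b

/-- The local structure at a node of a nice bag tree. -/
def NiceAt (t : BagTree V) (i : t.Node) : Prop :=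
  ((∀ j, t.parent j ≠ some i) ∧ ∃ u, t.bagAt i = {u}) ∨
  (∃ j, (∀ j', t.parent j' = some i ↔ j' = j) ∧
    ((∃ u, u ∉ t.bagAt j ∧ t.bagAt i = insert u (t.bagAt j)) ∨
      ∃ u ∈ t.bagAt j, t.bagAt i = (t.bagAt j).erase u)) ∨
  ∃ j k, j ≠ k ∧ (∀ j', t.parent j' = some i ↔ j' = j ∨ j' = k) ∧
    t.bagAt j = t.bagAt i ∧ t.bagAt k = t.bagAt i

theorem Nice.niceAt {t : BagTree V} (ht : t.Nice) (i : t.Node) : t.NiceAt i := by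
  induction t with
  | leaf b => exact Or.inl ⟨fun j => by simp [parent], ht⟩
  | un b t ih =>
    rcases i with _ | i
    · refine Or.inr (Or.inl ⟨some t.root, ?_, ?_⟩)
      · rintro (_ | j)
        · simp [parent]
        · simp [parent, parent_eq_none]
      · simpa only [bagAt, bagAt_root] using ht.2
    · rcases ih ht.1 i with ⟨h1, h2⟩ | ⟨j, h1, h2⟩ | ⟨j, k, hjk, h1, h2⟩
      · refine Or.inl ⟨?_, h2⟩
        rintro (_ | j)
        · simp [parent]
        · simpa [parent] using h1 j
      · refine Or.inr (Or.inl ⟨some j, ?_, h2⟩)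
        rintro (_ | j)
        · simp [parent]
        · simpa [parent] using h1 j
      · refine Or.inr (Or.inr ⟨some j, some k, by simpa using hjk, ?_, h2⟩)
        rintro (_ | j)
        · simp [parent]
        · simpa [parent] using h1 j
  | bin b t₁ t₂ ih₁ ih₂ =>
    obtain ⟨ht₁, ht₂, hb₁, hb₂⟩ := ht
    rcases i with _ | i | i
    · refine Or.inr (Or.inr ⟨some (.inl t₁.root), some (.inr t₂.root), by simp, ?_, ?_⟩)
      · rintro (_ | j | j)
        · simp [parent]
        · simp [parent, parent_eq_none]
        · simp [parent, parent_eq_none]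
      · simp only [bagAt, bagAt_root, hb₁, hb₂, and_self]
    · rcases ih₁ ht₁ i with ⟨h1, h2⟩ | ⟨j, h1, h2⟩ | ⟨j, k, hjk, h1, h2⟩
      · refine Or.inl ⟨?_, h2⟩
        rintro (_ | j | j)
        · simp [parent]
        · simpa [parent] using h1 j
        · simp [parent]
      · refine Or.inr (Or.inl ⟨some (.inl j), ?_, h2⟩)
        rintro (_ | j | j)
        · simp [parent]
        · simpa [parent] using h1 j
        · simp [parent]
      · refine Or.inr (Or.inr ⟨some (.inl j), some (.inl k), by simpa using hjk, ?_, h2⟩)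
        rintro (_ | j | j)
        · simp [parent]
        · simpa [parent] using h1 j
        · simp [parent]
    · rcases ih₂ ht₂ i with ⟨h1, h2⟩ | ⟨j, h1, h2⟩ | ⟨j, k, hjk, h1, h2⟩
      · refine Or.inl ⟨?_, h2⟩
        rintro (_ | j | j)
        · simp [parent]
        · simp [parent]
        · simpa [parent] using h1 j
      · refine Or.inr (Or.inl ⟨some (.inr j), ?_, h2⟩)
        rintro (_ | j | j)
        · simp [parent]
        · simp [parent]
        · simpa [parent] using h1 j
      · refine Or.inr (Or.inr ⟨some (.inr j), some (.inr k), by simpa using hjk, ?_, h2⟩)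
        rintro (_ | j | j)
        · simp [parent]
        · simp [parent]
        · simpa [parent] using h1 j

theorem Nice.isNice [Fintype V] {G : SimpleGraph V} {t : BagTree V} (ht : t.Nice) {univ : V}
    (htop : t.top = {univ}) (hc : t.Conn) (hv : ∀ v, t.Verts v)
    (he : ∀ u v, G.Adj u v → ∃ c, t.HasBag c ∧ u ∈ c ∧ v ∈ c) :
    (t.toRooted hc hv he).IsNice univ := by
  refine ⟨(bagAt_root t).trans htop, fun i => ?_⟩
  have hf : ∀ p i : (t.toRooted hc hv he).I, (t.toRooted hc hv he).Father p i ↔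
    t.parent i = some p := fun p i => toRooted_father
  rcases ht.niceAt i with ⟨h1, u, h2⟩ | ⟨j, h1, ⟨u, h2⟩ | ⟨u, h2⟩⟩ | ⟨j, k, hjk, h1, h2, h3⟩
  · exact ⟨.introduce u, Or.inl ⟨fun j hj => h1 j ((hf _ _).1 hj), h2⟩⟩
  · exact ⟨.introduce u, Or.inr ⟨j, fun j' => (hf _ _).trans (h1 j'), h2⟩⟩
  · exact ⟨.forget u, ⟨j, fun j' => (hf _ _).trans (h1 j'), h2⟩⟩
  · exact ⟨.join _ _ _, ⟨j, k, hjk, fun j' => (hf _ _).trans (h1 j'), h2, h3, rfl, rfl, rfl⟩⟩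

end BagTree

end VCTreewidth

/-! ### Transforming a tree decomposition into a nice one. -/

namespace VCTreewidth

namespace BagTree

variable {V : Type*} [DecidableEq V]

/-- The bag tree of a nice tree decomposition with bags of size at most `n`. -/
structure Good (n : ℕ) (t : BagTree V) : Prop where
  nice : t.Nice
  conn : t.Conn
  card_le : ∀ c, t.HasBag c → c.card ≤ n

/-- The vertices of `s` are forgotten one at a time, those outside the top bag being skipped. Old
bags survive, so covered edges stay covered. -/
theorem Good.exists_forget {n : ℕ} {t : BagTree V} (ht : t.Good n) (s : Finset V) :
    ∃ t' : BagTree V, t'.Good n ∧ t'.top = t.top \ s ∧ (∀ v, t'.Verts v ↔ t.Verts v) ∧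
      ∀ c, t.HasBag c → t'.HasBag c := by
  induction s using Finset.induction_on with
  | empty => exact ⟨t, ht, by simp, fun _ => Iff.rfl, fun _ h => h⟩
  | insert a s _ ih =>
    obtain ⟨t', h1, h2, h3, h4⟩ := ih
    have he : t.top \ insert a s = t'.top.erase a := by
      rw [h2]; ext v; simp only [Finset.mem_sdiff, Finset.mem_insert, Finset.mem_erase]; tauto
    by_cases ha : a ∈ t'.top
    · refine ⟨un (t'.top.erase a) t', ⟨⟨h1.nice, Or.inr ⟨a, ha, rfl⟩⟩,
        ⟨h1.conn, fun v hv _ => Finset.mem_of_mem_erase hv⟩, ?_⟩, he.symm, fun v => ?_,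
        fun c hc => Or.inr (h4 c hc)⟩
      · rintro c (rfl | hc)
        · exact (Finset.card_erase_le).trans (h1.card_le _ t'.hasBag_top)
        · exact h1.card_le c hc
      · rw [verts_un, ← h3]
        exact or_iff_right_of_imp fun h => verts_of_mem_top (Finset.mem_of_mem_erase h)
    · exact ⟨t', h1, by rw [he, Finset.erase_eq_of_notMem ha], h3, h4⟩

/-- Introducing vertices one at a time keeps connectedness because they are new to `t`. The
intermediate top bags are contained in the final one, so only its size has to be bounded. -/
theorem Good.exists_introduce {n : ℕ} {t : BagTree V} (ht : t.Good n) (s : Finset V)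
    (hs : ∀ v ∈ s, ¬ t.Verts v) (hn : (t.top ∪ s).card ≤ n) :
    ∃ t' : BagTree V, t'.Good n ∧ t'.top = t.top ∪ s ∧ (∀ v, t'.Verts v ↔ v ∈ s ∨ t.Verts v) ∧
      ∀ c, t.HasBag c → t'.HasBag c := by
  induction s using Finset.induction_on with
  | empty => exact ⟨t, ht, by simp, fun _ => by simp, fun _ h => h⟩
  | insert a s ha ih =>
    have he : t.top ∪ insert a s = insert a (t.top ∪ s) := by
      ext v; simp only [Finset.mem_union, Finset.mem_insert]; tauto
    obtain ⟨t', h1, h2, h3, h4⟩ := ih (fun v hv => hs v (Finset.mem_insert_of_mem hv))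
      ((Finset.card_le_card (by rw [he]; exact Finset.subset_insert _ _)).trans hn)
    have hat : ¬ t'.Verts a := by
      rw [h3]
      exact not_or.2 ⟨ha, hs a (Finset.mem_insert_self a s)⟩
    refine ⟨un (insert a t'.top) t', ⟨⟨h1.nice, Or.inl ⟨a, fun h => hat (verts_of_mem_top h), rfl⟩⟩,
      ⟨h1.conn, fun v hv hvt => ?_⟩, ?_⟩, by rw [he, ← h2]; rfl, fun v => ?_,
      fun c hc => Or.inr (h4 c hc)⟩
    · rcases Finset.mem_insert.1 hv with rfl | hv
      · exact (hat hvt).elim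
      · exact hv
    · rintro c (rfl | hc)
      · rw [h2, ← he]; exact hn
      · exact h1.card_le c hc
    · have := verts_of_mem_top (t := t') (v := v)
      have := h3 v
      rw [verts_un, Finset.mem_insert, Finset.mem_insert]
      tauto

theorem exists_good_of_bag {n : ℕ} {b : Finset V} (hb : b.Nonempty) (hn : b.card ≤ n) :
    ∃ t : BagTree V, t.Good n ∧ t.top = b ∧ ∀ v, t.Verts v ↔ v ∈ b := by
  obtain ⟨u, hu⟩ := hb
  have h0 : (leaf {u} : BagTree V).Good n := by
    refine ⟨⟨u, rfl⟩, trivial, ?_⟩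
    rintro c rfl
    exact le_trans (by rw [Finset.card_singleton]; exact Finset.card_pos.2 ⟨u, hu⟩) hn
  have he : {u} ∪ b.erase u = b := by
    rw [← Finset.insert_eq, Finset.insert_erase hu]
  obtain ⟨t, h1, h2, h3, -⟩ := h0.exists_introduce (b.erase u)
    (fun v hv h => Finset.ne_of_mem_erase hv (by simpa using h))
    (by simpa only [top, he] using hn)
  refine ⟨t, h1, h2.trans he, fun v => ?_⟩
  rw [h3, verts_leaf]
  rw [or_comm, ← Finset.mem_union, he]

end BagTree

open BagTree

variable {V : Type*} [Fintype V] [DecidableEq V] {G : SimpleGraph V}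

namespace RootedTreeDecomp

variable {D : RootedTreeDecomp G}

/-- The part of a nice tree decomposition that is made of a node and some of its children. -/
theorem exists_good_of_children {n : ℕ} {i : D.I} (hn : (D.bag i).card ≤ n)
    (ih : ∀ j, D.Father i j → D.below j = ∅ ∨ ∃ t : BagTree V, t.Good n ∧ t.top = D.bag j ∧
      (∀ v, t.Verts v ↔ v ∈ D.below j) ∧ ∀ k, D.Above j k → ∃ c, t.HasBag c ∧ D.bag k ⊆ c)
    (s : Finset D.I) (hs : ∀ j ∈ s, D.Father i j) :
    (∀ v, ¬ (v ∈ D.bag i ∨ ∃ j ∈ s, v ∈ D.below j)) ∨ ∃ t : BagTree V, t.Good n ∧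
      t.top = D.bag i ∧ (∀ v, t.Verts v ↔ v ∈ D.bag i ∨ ∃ j ∈ s, v ∈ D.below j) ∧
      ∀ j ∈ s, ∀ k, D.Above j k → ∃ c, t.HasBag c ∧ D.bag k ⊆ c := by
  classical
  induction s using Finset.induction_on with
  | empty =>
    -- The leaves of a nice bag tree are singletons, so nothing can represent a subtree with empty
    -- bags only; hence the first alternative in the statement.
    rcases (D.bag i).eq_empty_or_nonempty with h | h
    · exact Or.inl fun v => by simp [h]
    · obtain ⟨t, h1, h2, h3⟩ := exists_good_of_bag h hn
      exact Or.inr ⟨t, h1, h2, fun v => by simp [h3], by simp⟩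
  | insert j s hjs ihs =>
    have hj := hs j (Finset.mem_insert_self j s)
    have hU : ∀ v, (v ∈ D.bag i ∨ ∃ k ∈ insert j s, v ∈ D.below k) ↔
        v ∈ D.below j ∨ v ∈ D.bag i ∨ ∃ k ∈ s, v ∈ D.below k := by
      intro v
      simp only [Finset.mem_insert, exists_eq_or_imp]
      tauto
    simp only [hU]
    rcases ih j hj with hemp | ⟨t', g1, g2, g3, g4⟩
    · simp only [hemp, Finset.notMem_empty, false_or]
      rcases ihs fun k hk => hs k (Finset.mem_insert_of_mem hk) with h | ⟨t, h1, h2, h3, h4⟩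
      · exact Or.inl h
      · refine Or.inr ⟨t, h1, h2, h3, fun k hk l hl => ?_⟩
        rcases Finset.mem_insert.1 hk with rfl | hk
        · refine ⟨_, t.hasBag_top, fun v hv => ?_⟩
          have : v ∈ D.below k := mem_below.2 ⟨l, hl, hv⟩
          simp [hemp] at this
        · exact h4 k hk l hl
    -- The bag of the child is turned into the bag of `i`, forgetting before introducing so that no
    -- bag exceeds the larger of the two.
    · obtain ⟨t₁, a1, a2, a3, a4⟩ := g1.exists_forget (D.bag j \ D.bag i)
      have hint : t₁.top ∪ (D.bag i \ D.bag j) = D.bag i := by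
        rw [a2, g2]
        ext v
        simp only [Finset.mem_union, Finset.mem_sdiff]
        tauto
      obtain ⟨t₂, b1, b2, b3, b4⟩ := a1.exists_introduce (D.bag i \ D.bag j)
        (fun v hv hvt => by
          rw [Finset.mem_sdiff] at hv
          rw [a3, g3] at hvt
          exact hv.2 (hj.mem_bag_of_mem_below hvt hv.1)) (by rw [hint]; exact hn)
      rw [hint] at b2
      have hV : ∀ v, t₂.Verts v ↔ v ∈ D.below j ∨ v ∈ D.bag i := by
        intro v
        rw [b3, a3, g3, Finset.mem_sdiff]
        have := @bag_subset_below V _ _ G D j v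
        tauto
      have hbag : ∀ k, D.Above j k → ∃ c, t₂.HasBag c ∧ D.bag k ⊆ c := by
        intro k hk
        obtain ⟨c, hc, hck⟩ := g4 k hk
        exact ⟨c, b4 c (a4 c hc), hck⟩
      refine Or.inr ?_
      rcases ihs fun k hk => hs k (Finset.mem_insert_of_mem hk) with h | ⟨t, h1, h2, h3, h4⟩
      · refine ⟨t₂, b1, b2, fun v => ?_, fun k hk l hl => ?_⟩
        · rw [hV]
          have := h v
          generalize (∃ k ∈ s, v ∈ D.below k) = P at this ⊢
          tauto
        · rcases Finset.mem_insert.1 hk with rfl | hk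
          · exact hbag l hl
          · refine ⟨_, t₂.hasBag_top, fun v hv => ?_⟩
            exact (h v (Or.inr ⟨k, hk, mem_below.2 ⟨l, hl, hv⟩⟩)).elim
      -- A node with several children becomes a chain of binary joins with the same bag. A vertex
      -- occurring on both sides is below two siblings, hence in the bag of `i`.
      · refine ⟨bin (D.bag i) t t₂, ⟨⟨h1.nice, b1.nice, h2, b2⟩, ⟨h1.conn, b1.conn,
          fun v hv _ => h2 ▸ hv, fun v hv _ => b2 ▸ hv, fun v hv hv' => ?_⟩, ?_⟩, rfl,
          fun v => ?_, fun k hk l hl => ?_⟩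
        · rw [h3] at hv
          rw [hV] at hv'
          rcases hv with hv | ⟨k, hk, hv⟩
          · exact hv
          rcases hv' with hv' | hv'
          · obtain ⟨a, ha, hva⟩ := mem_below.1 hv
            obtain ⟨b, hb, hvb⟩ := mem_below.1 hv'
            refine mem_bag_of_siblings (hs k (Finset.mem_insert_of_mem hk)) hj ?_ ha hb hva hvb
            rintro rfl
            exact hjs hk
          · exact hv'
        · rintro c (rfl | hc | hc)
          · exact hn
          · exact h1.card_le c hc
          · exact b1.card_le c hc
        · rw [verts_bin, h3, hV]
          generalize (∃ k ∈ s, v ∈ D.below k) = P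
          tauto
        · rcases Finset.mem_insert.1 hk with rfl | hk
          · obtain ⟨c, hc, hlc⟩ := hbag l hl
            exact ⟨c, Or.inr (Or.inr hc), hlc⟩
          · obtain ⟨c, hc, hlc⟩ := h4 k hk l hl
            exact ⟨c, Or.inr (Or.inl hc), hlc⟩

theorem exists_good {n : ℕ} (hn : ∀ i, (D.bag i).card ≤ n) (i : D.I) :
    D.below i = ∅ ∨ ∃ t : BagTree V, t.Good n ∧ t.top = D.bag i ∧
      (∀ v, t.Verts v ↔ v ∈ D.below i) ∧ ∀ k, D.Above i k → ∃ c, t.HasBag c ∧ D.bag k ⊆ c := by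
  classical
  induction i using (wellFounded_child (D := D)).induction with
  | _ i ih =>
    have hU : ∀ v, (v ∈ D.bag i ∨ ∃ j ∈ Finset.univ.filter (D.Father i), v ∈ D.below j) ↔
        v ∈ D.below i := by
      intro v
      rw [mem_below_iff]
      simp
    rcases exists_good_of_children (hn i) ih (Finset.univ.filter (D.Father i)) (by simp) with
      h | ⟨t, h1, h2, h3, h4⟩
    · left
      simp only [hU] at h
      exact Finset.eq_empty_of_forall_notMem h
    · refine Or.inr ⟨t, h1, h2, fun v => (h3 v).trans (hU v), fun k hk => ?_⟩
      rcases hk.eq_or_exists_child with rfl | ⟨j, hj, hjk⟩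
      · exact ⟨_, t.hasBag_top, h2.ge⟩
      · exact h4 j (by simpa using hj) k hjk

end RootedTreeDecomp

/-- Every tree decomposition can be transformed into a nice one, without increasing the width. -/
theorem TreeDecomp.exists_isNice (D : TreeDecomp G) {n : ℕ} (hn : ∀ i, (D.bag i).card ≤ n)
    (univ : V) : ∃ D' : RootedTreeDecomp G, D'.IsNice univ ∧ ∀ i, (D'.bag i).card ≤ n := by
  obtain ⟨r, hr⟩ := D.cover univ
  let D₀ : RootedTreeDecomp G := { D with root := r }
  have hroot : ∀ i, D₀.Above r i := RootedTreeDecomp.above_root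
  rcases RootedTreeDecomp.exists_good (D := D₀) hn r with h | ⟨t, h1, h2, h3, h4⟩
  · have : univ ∈ D₀.below r := RootedTreeDecomp.bag_subset_below (D := D₀) r hr
    simp [h] at this
  · obtain ⟨t', a1, a2, a3, a4⟩ := h1.exists_forget (D.bag r \ {univ})
    have htop : t'.top = {univ} := by
      rw [a2, h2]
      exact Finset.sdiff_sdiff_eq_self (Finset.singleton_subset_iff.2 hr)
    have hv : ∀ v, t'.Verts v := by
      intro v
      rw [a3, h3]
      obtain ⟨i, hi⟩ := D.cover v
      exact RootedTreeDecomp.mem_below.2 ⟨i, hroot i, hi⟩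
    have he : ∀ u v, G.Adj u v → ∃ c, t'.HasBag c ∧ u ∈ c ∧ v ∈ c := by
      intro u v huv
      obtain ⟨i, hu, hv⟩ := D.edge u v huv
      obtain ⟨c, hc, hic⟩ := h4 i (hroot i)
      exact ⟨c, a4 c hc, hic hu, hic hv⟩
    exact ⟨t'.toRooted a1.conn hv he, a1.nice.isNice htop a1.conn hv he,
      fun i => a1.card_le _ (hasBag_iff.2 ⟨i, rfl⟩)⟩

end VCTreewidth

/-! ### Bounds on `loctw` and `ptw`, and the recursion of `ptw` as an existence statement. -/

namespace VCTreewidth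

variable {V : Type*} [Fintype V] [DecidableEq V] {G : SimpleGraph V} {univ : V} {C : Finset V}

theorem eps_nonneg (Q : Quintuple V) : 0 ≤ eps G C Q := by
  unfold eps
  split_ifs <;> norm_num

theorem neg_one_le_loctw (Q : Quintuple V) : -1 ≤ loctw G C Q := by
  have h1 := le_max_right (max (((XTR G C Q).card : ℤ) + (XL G C Q).card)
    (((XTR G C Q).card : ℤ) + (XR G C Q).card)) (eps G C Q)
  have h2 := eps_nonneg (G := G) (C := C) Q
  unfold loctw
  omega

theorem loctw_le_iff {Q : Quintuple V} {k : ℤ} : loctw G C Q ≤ k ↔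
    (Q.X.card : ℤ) + (XTR G C Q).card + (XL G C Q).card ≤ k + 1 ∧
    (Q.X.card : ℤ) + (XTR G C Q).card + (XR G C Q).card ≤ k + 1 ∧
    (Q.X.card : ℤ) + eps G C Q ≤ k + 1 := by
  have h : loctw G C Q ≤ k ↔ max (max (((XTR G C Q).card : ℤ) + (XL G C Q).card)
    (((XTR G C Q).card : ℤ) + (XR G C Q).card)) (eps G C Q) ≤ k + 1 - Q.X.card := by
    unfold loctw
    constructor <;> intro h <;> linarith
  rw [h, max_le_iff, max_le_iff]
  constructor
  · rintro ⟨⟨h1, h2⟩, h3⟩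
    exact ⟨by linarith, by linarith, by linarith⟩
  · rintro ⟨h1, h2, h3⟩
    exact ⟨⟨by linarith, by linarith⟩, by linarith⟩

theorem loctw_le_ptw (Q : Quintuple V) : (loctw G C Q : WithTop ℤ) ≤ ptw G univ C Q := by
  rw [ptw]
  split_ifs
  · exact le_rfl
  · split <;> split_ifs <;> first | exact le_max_left _ _ | exact le_top

/-- Integrality: if all elements exceed `k`, then `k + 1` is a lower bound. -/
theorem sInf_le_coe_iff {S : Set (WithTop ℤ)} (hS : BddBelow S) {k : ℤ} :
    sInf S ≤ (k : WithTop ℤ) ↔ ∃ t ∈ S, t ≤ (k : WithTop ℤ) := by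
  have hg := WithTop.isGLB_sInf' hS
  constructor
  · intro h
    by_contra! hcon
    have : ((k + 1 : ℤ) : WithTop ℤ) ≤ sInf S := by
      refine hg.2 fun t ht => ?_
      have := hcon t ht
      induction t using WithTop.recTopCoe with
      | top => exact le_top
      | coe a =>
        rw [WithTop.coe_lt_coe] at this
        exact WithTop.coe_le_coe.2 this
    have := WithTop.coe_le_coe.1 (this.trans h)
    omega
  · rintro ⟨t, ht, htk⟩
    exact (hg.1 ht).trans htk

/-- The minimum of `ptw` over valid quintuples with given last four entries is at most `k` iff it is
so for one of them. -/
theorem sInf_ptw_le_iff {L X R : Finset V} {hi : Op V} {k : ℤ} :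
    sInf {t | ∃ τ : Op V, IsValid G univ C ⟨τ, L, X, R, hi⟩ ∧
      t = ptw G univ C ⟨τ, L, X, R, hi⟩} ≤ (k : WithTop ℤ) ↔
    ∃ τ : Op V, IsValid G univ C ⟨τ, L, X, R, hi⟩ ∧
      ptw G univ C ⟨τ, L, X, R, hi⟩ ≤ (k : WithTop ℤ) := by
  rw [sInf_le_coe_iff]
  · constructor
    · rintro ⟨t, ⟨τ, h, rfl⟩, hk⟩
      exact ⟨τ, h, hk⟩
    · rintro ⟨τ, h, hk⟩
      exact ⟨_, ⟨τ, h, rfl⟩, hk⟩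
  · refine ⟨((-1 : ℤ) : WithTop ℤ), ?_⟩
    rintro t ⟨τ, -, rfl⟩
    exact (WithTop.coe_le_coe.2 (neg_one_le_loctw _)).trans (loctw_le_ptw _)

theorem ptw_of_empty {Q : Quintuple V} (h : Q.L = ∅) : ptw G univ C Q = loctw G C Q := by
  rw [ptw, if_pos h]

/-- Some valid quintuple with the given last four entries has partial treewidth at most `k`. -/
def Feasible (G : SimpleGraph V) (univ : V) (C : Finset V) (k : ℤ) (L X R : Finset V)
    (hi : Op V) : Prop :=
  ∃ τ : Op V, IsValid G univ C ⟨τ, L, X, R, hi⟩ ∧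
    ptw G univ C ⟨τ, L, X, R, hi⟩ ≤ (k : WithTop ℤ)

variable {L X R : Finset V} {hi : Op V} {k : ℤ}

/-- This and the next two equivalences replace the recursion of `ptw`, with its minima and its value
`⊤` on irrelevant quintuples, by `Feasible`; both directions of the main proof use only them. -/
theorem ptw_introduce_le_iff {u : V} (hL : L ≠ ∅) :
    ptw G univ C ⟨.introduce u, L, X, R, hi⟩ ≤ (k : WithTop ℤ) ↔
      u ∈ X ∧ loctw G C ⟨.introduce u, L, X, R, hi⟩ ≤ k ∧
        Feasible G univ C k L (X \ {u}) (R ∪ {u}) (.introduce u) := by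
  rw [ptw, if_neg hL]
  simp only
  split_ifs with h
  · rw [max_le_iff, sInf_ptw_le_iff, WithTop.coe_le_coe]
    simp only [h, true_and]
    rfl
  · simp [h]

theorem ptw_forget_le_iff {u : V} (hL : L ≠ ∅) :
    ptw G univ C ⟨.forget u, L, X, R, hi⟩ ≤ (k : WithTop ℤ) ↔
      u ∈ L ∧ loctw G C ⟨.forget u, L, X, R, hi⟩ ≤ k ∧
        Feasible G univ C k (L \ {u}) (X ∪ {u}) R (.forget u) := by
  rw [ptw, if_neg hL]
  simp only
  split_ifs with h
  · rw [max_le_iff, sInf_ptw_le_iff, WithTop.coe_le_coe]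
    simp only [h, true_and]
    rfl
  · simp [h]

theorem ptw_join_le_iff {X' L₁ L₂ : Finset V} (hL : L ≠ ∅) :
    ptw G univ C ⟨.join X' L₁ L₂, L, X, R, hi⟩ ≤ (k : WithTop ℤ) ↔
      (L₁.card < L.card ∧ L₂.card < L.card) ∧ loctw G C ⟨.join X' L₁ L₂, L, X, R, hi⟩ ≤ k ∧
        Feasible G univ C k L₁ X (R ∪ L₂) (.join X L₁ L₂) ∧
        Feasible G univ C k L₂ X (R ∪ L₁) (.join X L₁ L₂) := by
  rw [ptw, if_neg hL]
  simp only
  split_ifs with h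
  · rw [max_le_iff, max_le_iff, sInf_ptw_le_iff, sInf_ptw_le_iff, WithTop.coe_le_coe]
    simp only [h, true_and]
    rfl
  · simp [h]

end VCTreewidth

/-! ### How lower set, bag and rest change from a node to its children; convexity of traces. -/

namespace VCTreewidth

namespace RootedTreeDecomp

variable {V : Type*} [Fintype V] [DecidableEq V] {G : SimpleGraph V} {D : RootedTreeDecomp G}
  {C : Finset V}

section Children

variable {i j k : D.I}

theorem lower_eq_empty (h : ∀ j, ¬ D.Father i j) : D.lower i = ∅ := by
  ext v
  simp [mem_lower, mem_below_iff (i := i), h]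

theorem father_of_only (h : ∀ j', D.Father i j' ↔ j' = j) : D.Father i j := (h j).2 rfl

theorem mem_below_iff_of_only (h : ∀ j', D.Father i j' ↔ j' = j) {v : V} :
    v ∈ D.below i ↔ v ∈ D.bag i ∨ v ∈ D.below j := by
  rw [mem_below_iff]
  simp [h]

section Introduce

variable {u : V} (h : ∀ j', D.Father i j' ↔ j' = j) (hu : u ∉ D.bag j)
  (hb : D.bag i = insert u (D.bag j))
include h hu hb

theorem introduce_notMem_below : u ∉ D.below j := fun hv =>
  hu ((father_of_only h).mem_bag_of_mem_below hv (by rw [hb]; exact Finset.mem_insert_self _ _))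

theorem introduce_lower : D.lower j = D.lower i := by
  ext v
  have h1 := introduce_notMem_below h hu hb
  have h2 := @bag_subset_below V _ _ G D j v
  rw [mem_lower, mem_lower, mem_below_iff_of_only h, hb, Finset.mem_insert]
  by_cases hvu : v = u
  · subst hvu; tauto
  · tauto

theorem introduce_rest : D.rest j = D.rest i ∪ {u} := by
  ext v
  have h1 := introduce_notMem_below h hu hb
  have h2 := @bag_subset_below V _ _ G D j v
  rw [Finset.mem_union, mem_rest, mem_rest, mem_below_iff_of_only h, hb, Finset.mem_insert,
    Finset.mem_singleton]
  by_cases hvu : v = u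
  · subst hvu; tauto
  · tauto

omit h in
theorem introduce_bag : D.bag j = D.bag i \ {u} := by
  ext v
  rw [hb, Finset.mem_sdiff, Finset.mem_insert, Finset.mem_singleton]
  by_cases hvu : v = u
  · subst hvu; tauto
  · tauto

end Introduce

section Forget

variable {u : V} (h : ∀ j', D.Father i j' ↔ j' = j) (hu : u ∈ D.bag j)
  (hb : D.bag i = (D.bag j).erase u)
include h hu hb

theorem forget_mem_lower : u ∈ D.lower i := by
  rw [mem_lower, mem_below_iff_of_only h, hb]
  exact ⟨Or.inr (bag_subset_below j hu), Finset.notMem_erase _ _⟩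

theorem forget_rest : D.rest j = D.rest i := by
  ext v
  have h2 := @bag_subset_below V _ _ G D j v
  rw [mem_rest, mem_rest, mem_below_iff_of_only h, hb, Finset.mem_erase]
  tauto

theorem forget_lower : D.lower j = D.lower i \ {u} := by
  ext v
  have h2 := @bag_subset_below V _ _ G D j v
  rw [Finset.mem_sdiff, mem_lower, mem_lower, mem_below_iff_of_only h, hb, Finset.mem_erase,
    Finset.mem_singleton]
  by_cases hvu : v = u
  · subst hvu; tauto
  · tauto

omit h in
theorem forget_bag : D.bag j = D.bag i ∪ {u} := by
  rw [hb, Finset.union_comm, ← Finset.insert_eq, Finset.insert_erase hu]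

end Forget

section Join

variable (hjk : j ≠ k) (h : ∀ j', D.Father i j' ↔ j' = j ∨ j' = k) (hj : D.bag j = D.bag i)
  (hk : D.bag k = D.bag i)
include h

theorem join_father_left : D.Father i j := (h j).2 (Or.inl rfl)

theorem join_father_right : D.Father i k := (h k).2 (Or.inr rfl)

include hj hk in
theorem join_lower : D.lower i = D.lower j ∪ D.lower k := by
  ext v
  rw [Finset.mem_union, mem_lower, mem_lower, mem_lower, hj, hk, mem_below_iff (i := i)]
  simp only [h, or_and_right, exists_or, exists_eq_left]
  tauto

include hjk in
theorem join_mem_bag {v : V} (h1 : v ∈ D.below j) (h2 : v ∈ D.below k) : v ∈ D.bag i := by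
  obtain ⟨a, ha, hva⟩ := mem_below.1 h1
  obtain ⟨b, hb, hvb⟩ := mem_below.1 h2
  exact mem_bag_of_siblings (join_father_left h) (join_father_right h) hjk ha hb hva hvb

include hjk hj hk in
theorem join_rest_left : D.rest j = D.rest i ∪ D.lower k := by
  ext v
  have h1 := @join_mem_bag V _ _ G D i j k hjk h v
  have h2 := @bag_subset_below V _ _ G D j v
  rw [hj] at h2
  rw [Finset.mem_union, mem_lower, mem_rest, mem_rest, hk, mem_below_iff (i := i)]
  simp only [h, or_and_right, exists_or, exists_eq_left]
  tauto

include hjk hj in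
theorem join_notMem_lower {v : V} (h1 : v ∈ D.lower j) (h2 : v ∈ D.lower k) : False := by
  have h3 := join_mem_bag hjk h (mem_lower.1 h1).1 (mem_lower.1 h2).1
  rw [← hj] at h3
  exact (mem_lower.1 h1).2 h3

end Join

end Children

section Traces

variable {i j : D.I}

theorem mem_bag_iff_not {v : V} : v ∈ D.bag i ↔ v ∉ D.lower i ∧ v ∉ D.rest i := by
  have := @bag_subset_below V _ _ G D i v
  rw [mem_lower, mem_rest]
  tauto

/-- A trace is determined by its lower and its upper part. -/
theorem HasTrace.of_lower_rest {L X R : Finset V} (hi : D.HasTrace C i L X R)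
    (hL : D.lower j ∩ C = L) (hR : D.rest j ∩ C = R) : D.HasTrace C j L X R := by
  obtain ⟨h1, h2, h3⟩ := hi
  refine ⟨hL, ?_, hR⟩
  rw [← h2]
  rw [← h1] at hL
  rw [← h3] at hR
  ext v
  have e1 := Finset.ext_iff.1 hL v
  have e2 := Finset.ext_iff.1 hR v
  simp only [Finset.mem_inter] at e1 e2 ⊢
  rw [mem_bag_iff_not, mem_bag_iff_not]
  tauto

theorem Above.rest_subset (h : D.Above i j) : D.rest i ⊆ D.rest j := fun _ hv =>
  mem_rest.2 fun h' => mem_rest.1 hv (h.below_subset h')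

/-- The nodes with a given trace form a convex set. -/
theorem HasTrace.convex {L X R : Finset V} {a b c : D.I} (ha : D.HasTrace C a L X R)
    (hc : D.HasTrace C c L X R) (hab : D.Above a b) (hbc : D.Above b c) :
    D.HasTrace C b L X R := by
  refine ha.of_lower_rest (subset_antisymm ?_ ?_) (subset_antisymm ?_ ?_)
  · exact (Finset.inter_subset_inter_right hab.lower_subset).trans ha.1.le
  · exact hc.1.ge.trans (Finset.inter_subset_inter_right hbc.lower_subset)
  · exact (Finset.inter_subset_inter_right hbc.rest_subset).trans hc.2.2.le
  · exact ha.2.2.ge.trans (Finset.inter_subset_inter_right hab.rest_subset)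

/-- Two nodes with a common vertex in their lower sets are comparable. -/
theorem above_or_above {v : V} (hi : v ∈ D.lower i) (hj : v ∈ D.lower j) :
    D.Above i j ∨ D.Above j i := by
  obtain ⟨a, ha, hva⟩ := mem_below.1 (mem_lower.1 hi).1
  exact ha.total (above_of_mem_lower hj hva)

end Traces

/-! ### The local treewidth is bounded by the width of a decomposition. -/

section LocalBounds

variable {i : D.I} {Q : Quintuple V}

theorem mem_lower_of_trace (h : D.HasTrace C i Q.L Q.X Q.R) {v : V} (hv : v ∈ Q.L) :
    v ∈ D.lower i := by
  rw [← h.1] at hv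
  exact (Finset.mem_inter.1 hv).1

theorem mem_rest_of_trace (h : D.HasTrace C i Q.L Q.X Q.R) {v : V} (hv : v ∈ Q.R) :
    v ∈ D.rest i := by
  rw [← h.2.2] at hv
  exact (Finset.mem_inter.1 hv).1

theorem bag_subset_of_trace (h : D.HasTrace C i Q.L Q.X Q.R) : Q.X ⊆ D.bag i := by
  rw [← h.2.1]
  exact Finset.inter_subset_left

theorem subset_of_trace (h : D.HasTrace C i Q.L Q.X Q.R) : Q.X ⊆ C := by
  rw [← h.2.1]
  exact Finset.inter_subset_right

theorem notMem_of_trace (h : D.HasTrace C i Q.L Q.X Q.R) {v : V} (hv : v ∈ Q.R) :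
    v ∉ Q.L ∧ v ∉ Q.X := by
  have h1 := mem_rest.1 (mem_rest_of_trace h hv)
  exact ⟨fun h' => h1 (mem_lower.1 (mem_lower_of_trace h h')).1,
    fun h' => h1 (bag_subset_below i (bag_subset_of_trace h h'))⟩

/-- A vertex with a neighbour in the rest of `i` has a bag outside the subtree of `i`. -/
theorem exists_bag_of_adj_rest {x w : V} (hw : w ∈ D.rest i) (h : G.Adj x w) :
    ∃ b, ¬ D.Above i b ∧ x ∈ D.bag b := by
  obtain ⟨b, hxb, hwb⟩ := D.edge x w h
  exact ⟨b, fun hb => mem_rest.1 hw (mem_below.2 ⟨b, hb, hwb⟩), hxb⟩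

theorem mem_below_of_adj_lower {x w : V} (hw : w ∈ D.lower i) (h : G.Adj x w) :
    x ∈ D.below i := by
  obtain ⟨a, hxa, hwa⟩ := D.edge x w h
  exact mem_below.2 ⟨a, above_of_mem_lower hw hwa, hxa⟩

theorem mem_XTR {x : V} : x ∈ XTR G C Q ↔
    x ∉ C ∧ (∃ w ∈ Q.L, G.Adj x w) ∧ ∃ w ∈ Q.R, G.Adj x w := by
  simp [XTR]

theorem XTR_subset_bag (h : D.HasTrace C i Q.L Q.X Q.R) : XTR G C Q ⊆ D.bag i := by
  intro x hx
  obtain ⟨-, ⟨w, hw, hxw⟩, w', hw', hxw'⟩ := mem_XTR.1 hx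
  obtain ⟨b, hb, hxb⟩ := exists_bag_of_adj_rest (mem_rest_of_trace h hw') hxw'
  exact mem_bag_of_mem_below (mem_below_of_adj_lower (mem_lower_of_trace h hw) hxw) hxb hb

theorem mem_XL_introduce {u : V} (hL : Q.L ≠ ∅) (hlo : Q.lo = .introduce u) {x : V} :
    x ∈ XL G C Q ↔ x ∉ C ∧ (∀ w, G.Adj x w → w ∈ Q.L ∪ Q.X) ∧ G.Adj x u ∧
      ∃ w ∈ Q.L, G.Adj x w := by
  rw [XL, if_neg hL, hlo]
  simp

theorem mem_XL_join {X L₁ L₂ : Finset V} (hL : Q.L ≠ ∅) (hlo : Q.lo = .join X L₁ L₂) {x : V} :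
    x ∈ XL G C Q ↔ x ∉ C ∧ (∃ w ∈ L₁, G.Adj x w) ∧ (∃ w ∈ L₂, G.Adj x w) ∧
      ∀ w ∈ Q.R, ¬ G.Adj x w := by
  rw [XL, if_neg hL, hlo]
  simp

theorem XL_forget {u : V} (hlo : Q.lo = .forget u) : XL G C Q = ∅ := by
  rw [XL, hlo]
  simp

theorem XL_of_empty (hL : Q.L = ∅) : XL G C Q = ∅ := by
  rw [XL, if_pos hL]

theorem mem_XR_forget {v : V} (hhi : Q.hi = .forget v) {x : V} :
    x ∈ XR G C Q ↔ x ∉ C ∧ (∀ w, G.Adj x w → w ∈ Q.R ∪ Q.X) ∧ G.Adj x v ∧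
      ∃ w ∈ Q.R, G.Adj x w := by
  rw [XR, hhi]
  simp

theorem exists_of_mem_XR {x : V} (hx : x ∈ XR G C Q) : ∃ v, Q.hi = .forget v := by
  rw [XR] at hx
  cases h : Q.hi with
  | forget v => exact ⟨v, rfl⟩
  | introduce u => simp [h] at hx
  | join X L₁ L₂ => simp [h] at hx

theorem notMem_of_mem_XL {x : V} (hx : x ∈ XL G C Q) : x ∉ C := by
  by_cases hL : Q.L = ∅
  · simp [XL_of_empty hL] at hx
  cases h : Q.lo with
  | introduce u => exact ((mem_XL_introduce hL h).1 hx).1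
  | forget u => simp [XL_forget h] at hx
  | join X L₁ L₂ => exact ((mem_XL_join hL h).1 hx).1

theorem not_adj_of_mem_XL (h : D.HasTrace C i Q.L Q.X Q.R) {x w : V} (hx : x ∈ XL G C Q)
    (hw : w ∈ Q.R) : ¬ G.Adj x w := by
  by_cases hL : Q.L = ∅
  · simp [XL_of_empty hL] at hx
  cases hlo : Q.lo with
  | introduce u =>
    intro hxw
    have h1 := ((mem_XL_introduce hL hlo).1 hx).2.1 w hxw
    have h2 := notMem_of_trace h hw
    rw [Finset.mem_union] at h1
    tauto
  | forget u => simp [XL_forget hlo] at hx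
  | join X L₁ L₂ => exact ((mem_XL_join hL hlo).1 hx).2.2.2 w hw

/-- At an introduction of `u`, the vertex has a bag below the child, from its neighbour in `L`, and
a bag outside that subtree, from `u`; so it is in the bag of `i`. At a join, it has bags below both
children. -/
theorem XL_subset_bag (h : D.HasTrace C i Q.L Q.X Q.R) {τ : Op V} (hτ : D.HasOp i τ)
    (hlo : τ.trace C = Q.lo) : XL G C Q ⊆ D.bag i := by
  intro x hx
  by_cases hL : Q.L = ∅
  · simp [XL_of_empty hL] at hx
  cases τ with
  | introduce u =>
    obtain ⟨-, -, hxu, w, hw, hxw⟩ := (mem_XL_introduce hL hlo.symm).1 hx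
    have hw' := mem_lower_of_trace h hw
    rcases hτ with ⟨h1, -⟩ | ⟨j, h1, h2, h3⟩
    · simp [lower_eq_empty h1] at hw'
    · rw [← introduce_lower h1 h2 h3] at hw'
      obtain ⟨b, hxb, hub⟩ := D.edge x u hxu
      have hb : ¬ D.Above j b := fun hb =>
        introduce_notMem_below h1 h2 h3 (mem_below.2 ⟨b, hb, hub⟩)
      obtain ⟨a, ha, hxa⟩ := mem_below.1 (mem_below_of_adj_lower hw' hxw)
      obtain ⟨-, p, hp, hxp⟩ := separation hxa hxb ha hb
      rwa [(father_of_only h1).unique hp]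
  | forget u => simp [XL_forget hlo.symm] at hx
  | join X L₁ L₂ =>
    obtain ⟨-, ⟨w, hw, hxw⟩, ⟨w', hw', hxw'⟩, -⟩ := (mem_XL_join hL hlo.symm).1 hx
    obtain ⟨j, k, hjk, h1, hj, hk, -, rfl, rfl⟩ := hτ
    exact join_mem_bag hjk h1 (mem_below_of_adj_lower (Finset.mem_inter.1 hw).1 hxw)
      (mem_below_of_adj_lower (Finset.mem_inter.1 hw').1 hxw')

/-- The operation above the node `i`, seen on `C`, is `hi`. -/
def OpAbove (D : RootedTreeDecomp G) (C : Finset V) (i : D.I) (hi : Op V) : Prop :=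
  (i = D.root ∧ ∃ r, D.bag D.root = {r} ∧ hi = .forget r) ∨
    ∃ p τ, D.Father p i ∧ D.HasOp p τ ∧ τ.trace C = hi

theorem rest_root : D.rest D.root = ∅ := by
  ext v
  obtain ⟨i, hi⟩ := D.cover v
  simp only [mem_rest, Finset.notMem_empty, iff_false, not_not]
  exact mem_below.2 ⟨i, above_root i, hi⟩

/-- The vertex `v` is forgotten just above `i`, so all its bags are below `i`, while a neighbour in
`R` forces a bag outside. At the root `R` is empty. -/
theorem XR_subset_bag (h : D.HasTrace C i Q.L Q.X Q.R) (hhi : D.OpAbove C i Q.hi) :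
    XR G C Q ⊆ D.bag i := by
  intro x hx
  obtain ⟨v, hv⟩ := exists_of_mem_XR hx
  obtain ⟨-, -, hxv, w, hw, hxw⟩ := (mem_XR_forget hv).1 hx
  have hw' := mem_rest_of_trace h hw
  rcases hhi with ⟨rfl, -⟩ | ⟨p, τ, hp, hτ, hτ'⟩
  · simp [rest_root] at hw'
  · rw [hv] at hτ'
    cases τ with
    | introduce u => cases hτ'
    | join X L₁ L₂ => cases hτ'
    | forget u =>
      cases hτ'
      obtain ⟨j, h1, h2, h3⟩ := hτ
      obtain rfl : i = j := (h1 i).1 hp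
      obtain ⟨b, hb, hxb⟩ := exists_bag_of_adj_rest hw' hxw
      obtain ⟨a, hxa, hva⟩ := D.edge x v hxv
      have ha : D.Above i a := by
        by_contra ha
        obtain ⟨-, q, hq, hvq⟩ := separation h2 hva (Above.refl i) ha
        rw [← hp.unique hq, h3] at hvq
        exact Finset.notMem_erase _ _ hvq
      exact mem_bag_of_mem_below (mem_below.2 ⟨a, ha, hxa⟩) hxb hb

theorem not_adj_of_mem_XR (h : D.HasTrace C i Q.L Q.X Q.R) {x w : V} (hx : x ∈ XR G C Q)
    (hw : w ∈ Q.L) : ¬ G.Adj x w := fun hxw => by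
  obtain ⟨v, hv⟩ := exists_of_mem_XR hx
  have h1 := ((mem_XR_forget hv).1 hx).2.1 w hxw
  rcases Finset.mem_union.1 h1 with h1 | h1
  · exact (notMem_of_trace h h1).1 hw
  · exact (mem_lower.1 (mem_lower_of_trace h hw)).2 (bag_subset_of_trace h h1)

/-- A vertex that is adjacent to the whole set `X` has a bag containing `X`, if `X` is contained in
some bag. -/
theorem exists_bag_of_adj {X : Finset V} {x : V} (hX : X ⊆ D.bag i) (hx : ∀ w ∈ X, G.Adj x w) :
    ∃ a, x ∈ D.bag a ∧ X ⊆ D.bag a := by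
  classical
  obtain ⟨a₀, ha₀⟩ := D.cover x
  obtain ⟨a, ha, hmin⟩ := Finset.exists_min_image
    (Finset.univ.filter fun a => x ∈ D.bag a) D.depth ⟨a₀, by simpa using ha₀⟩
  simp only [Finset.mem_filter, Finset.mem_univ, true_and] at ha hmin
  -- The node `a` is the top of the subtree of bags containing `x`.
  have habove : ∀ b, x ∈ D.bag b → D.Above a b := by
    intro b hb
    by_contra hab
    obtain ⟨-, p, hp, hxp⟩ := separation ha hb (Above.refl a) hab
    have := hmin p hxp
    have := hp.depth_eq
    omega
  by_cases hai : D.Above a i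
  -- On the way from `a` to `i`, let `p` be the last node whose bag contains `x`, and `c` the next
  -- one. Each `w ∈ X` is in the bag of `i`, below `c`, and meets `x` in a bag outside the subtree
  -- of `c`; hence it is in the bag of `p`.
  · obtain ⟨p, hp, hmax⟩ := Finset.exists_max_image
      (Finset.univ.filter fun p => x ∈ D.bag p ∧ D.Above p i) D.depth ⟨a, by simp [ha, hai]⟩
    simp only [Finset.mem_filter, Finset.mem_univ, true_and] at hp hmax
    rcases hp.2.eq_or_exists_child with rfl | ⟨c, hc, hci⟩
    · exact ⟨_, hp.1, hX⟩
    · have hxc : x ∉ D.bag c := fun hxc => by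
        have := hmax c ⟨hxc, hci⟩
        have := hc.depth_eq
        omega
      refine ⟨p, hp.1, fun w hw => ?_⟩
      obtain ⟨b, hxb, hwb⟩ := D.edge x w (hx w hw)
      have hb : ¬ D.Above c b := fun hb => hxc (separation hxb hp.1 hb hc.not_above).1
      obtain ⟨-, q, hq, hwq⟩ := separation (hX hw) hwb hci hb
      rwa [hc.unique hq]
  · refine ⟨a, ha, fun w hw => ?_⟩
    obtain ⟨b, hxb, hwb⟩ := D.edge x w (hx w hw)
    exact (separation hwb (hX hw) (habove b hxb) hai).1

theorem card_add_card_add_card_le {A B E F : Finset V} (hA : A ⊆ C) (hB : ∀ x ∈ B, x ∉ C)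
    (hE : ∀ x ∈ E, x ∉ C) (hBE : ∀ x ∈ B, x ∉ E) (hAF : A ⊆ F) (hBF : B ⊆ F) (hEF : E ⊆ F) :
    A.card + B.card + E.card ≤ F.card := by
  rw [← Finset.card_union_of_disjoint (Finset.disjoint_left.2 fun x hx hx' => hB x hx' (hA hx)),
    ← Finset.card_union_of_disjoint]
  · exact Finset.card_le_card (Finset.union_subset (Finset.union_subset hAF hBF) hEF)
  · rw [Finset.disjoint_left]
    intro x hx hx'
    rcases Finset.mem_union.1 hx with hx | hx
    · exact hE x hx' (hA hx)
    · exact hBE x hx hx'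

/-- The local treewidth of a quintuple is bounded by the width of the nice tree decompositions that
respect it. -/
theorem loctw_le {k : ℤ} (hk : ∀ i, ((D.bag i).card : ℤ) ≤ k + 1) {imin imax : D.I}
    (hmin : D.HasTrace C imin Q.L Q.X Q.R) (hmax : D.HasTrace C imax Q.L Q.X Q.R)
    (hlo : Q.L = ∅ ∨ ∃ τ, D.HasOp imin τ ∧ τ.trace C = Q.lo) (hhi : D.OpAbove C imax Q.hi) :
    loctw G C Q ≤ k := by
  have hXTR : ∀ x ∈ XTR G C Q, x ∉ C := fun x hx => (mem_XTR.1 hx).1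
  -- The first two bounds come from the bags of `imin` and `imax`, which may differ; the bound with
  -- `ε` may need a third bag, anywhere in the tree.
  refine loctw_le_iff.2 ⟨le_trans ?_ (hk imin), le_trans ?_ (hk imax), ?_⟩
  · norm_cast
    refine card_add_card_add_card_le (subset_of_trace hmin) hXTR (fun x hx => notMem_of_mem_XL hx)
      ?_ (bag_subset_of_trace hmin) (XTR_subset_bag hmin) ?_
    · intro x hx hx'
      obtain ⟨-, -, w, hw, hxw⟩ := mem_XTR.1 hx
      exact not_adj_of_mem_XL hmin hx' hw hxw
    · rcases hlo with hlo | ⟨τ, hτ, hτ'⟩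
      · simp [XL_of_empty hlo]
      · exact XL_subset_bag hmin hτ hτ'
  · norm_cast
    refine card_add_card_add_card_le (subset_of_trace hmax) hXTR (fun x hx => ?_)
      ?_ (bag_subset_of_trace hmax) (XTR_subset_bag hmax) (XR_subset_bag hmax hhi)
    · obtain ⟨v, hv⟩ := exists_of_mem_XR hx
      exact ((mem_XR_forget hv).1 hx).1
    · intro x hx hx'
      obtain ⟨-, ⟨w, hw, hxw⟩, -⟩ := mem_XTR.1 hx
      exact not_adj_of_mem_XR hmax hx' hw hxw
  · unfold eps
    split_ifs with h
    · obtain ⟨x, hx, hN⟩ := h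
      obtain ⟨a, hxa, ha⟩ := exists_bag_of_adj (bag_subset_of_trace hmax) fun w hw => (hN w).2 hw
      refine le_trans ?_ (hk a)
      have : (insert x Q.X).card ≤ (D.bag a).card :=
        Finset.card_le_card (Finset.insert_subset hxa ha)
      rw [Finset.card_insert_of_notMem fun h' => hx (subset_of_trace hmax h')] at this
      exact_mod_cast this
    · rw [add_zero]
      exact le_trans (by exact_mod_cast Finset.card_le_card (bag_subset_of_trace hmax)) (hk imax)

end LocalBounds

end RootedTreeDecomp

end VCTreewidth

/-! ### From a nice tree decomposition to quintuples of small partial treewidth. -/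

namespace VCTreewidth

namespace RootedTreeDecomp

variable {V : Type*} [Fintype V] [DecidableEq V] {G : SimpleGraph V} {D : RootedTreeDecomp G}
  {univ : V} {C : Finset V} {k : ℤ}

theorem HasTrace.isValidPartition {i : D.I} {L X R : Finset V} (h : D.HasTrace C i L X R) :
    IsValidPartition G C L X R := ⟨D, i, h⟩

/-- If `i` is the highest node with its trace, and the operation above `i` is `hi`, then a valid
quintuple with this trace and this last entry has partial treewidth at most `k`. -/
theorem feasible (hD : D.IsNice univ) (hk : ∀ i, ((D.bag i).card : ℤ) ≤ k + 1) (i : D.I) :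
    ∀ (L X R : Finset V) (hi : Op V), D.HasTrace C i L X R → D.OpAbove C i hi →
      (∀ p, D.Father p i → ¬ D.HasTrace C p L X R) →
      (L = ∅ → ∃ u ∈ X, hi = .forget u ∧ ∀ w ∈ C, G.Adj u w → w ∈ X) →
      Feasible G univ C k L X R hi := by
  classical
  -- The recursion jumps from `i` to the children of the lowest node with the same trace, which may
  -- lie several levels below; hence the transitive closure.
  induction i using (wellFounded_child (D := D)).transGen.induction with
  | _ i ih =>
    intro L X R hi htr hop htop hdeg
    by_cases hL : L = ∅
    · obtain ⟨u, hu⟩ := hdeg hL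
      refine ⟨.introduce u, Or.inr ⟨hL, htr.isValidPartition, u, hu⟩, ?_⟩
      rw [ptw_of_empty hL, WithTop.coe_le_coe]
      exact loctw_le hk htr htr (Or.inl hL) hop
    obtain ⟨m, hm, hmax⟩ := Finset.exists_max_image
      (Finset.univ.filter fun m => D.HasTrace C m L X R) D.depth ⟨i, by simpa using htr⟩
    simp only [Finset.mem_filter, Finset.mem_univ, true_and] at hm hmax
    -- A vertex `v ∈ L` is in the lower set of every node with this trace, so these nodes are
    -- pairwise comparable. This fails for `L = ∅`, which is treated as degenerate.
    obtain ⟨v, hv⟩ := Finset.nonempty_iff_ne_empty.2 hL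
    have hlow : ∀ {j}, D.HasTrace C j L X R → v ∈ D.lower j := by
      intro j hj
      rw [← hj.1] at hv
      exact (Finset.mem_inter.1 hv).1
    have habove : ∀ j, D.HasTrace C j L X R → D.Above i j := by
      intro j hj
      rcases above_or_above (hlow htr) (hlow hj) with h | h
      · exact h
      · by_cases hr : i = D.root
        · rw [hr]; exact above_root j
        · obtain ⟨p, hp⟩ := exists_father hr
          rcases h.eq_or_above_father hp with rfl | h'
          · exact Above.refl _
          · exact (htop p hp (hj.convex htr h' hp.above)).elim
    have hbelow : ∀ j, D.HasTrace C j L X R → D.Above j m := by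
      intro j hj
      rcases above_or_above (hlow hj) (hlow hm) with h | h
      · exact h
      · rcases h.eq_or_depth_lt with rfl | h'
        · exact Above.refl _
        · exact (not_lt_of_ge (hmax j hj) h').elim
    have hchild : ∀ j, D.Father m j → ¬ D.HasTrace C j L X R := fun j hj hj' => by
      have := hmax j hj'
      have := hj.depth_eq
      omega
    have htrans : ∀ j, D.Father m j → Relation.TransGen (fun j i => D.Father i j) j i := by
      intro j hj
      have h1 : Relation.TransGen D.Father i j := Relation.TransGen.tail' (habove m hm) hj
      exact Relation.transGen_swap.1 h1
    have hrec : ∀ (j : D.I) (τ : Op V), D.Father m j → D.HasOp m τ →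
        (D.lower j ∩ C = ∅ → ∃ u ∈ D.bag j ∩ C, τ.trace C = .forget u ∧
          ∀ w ∈ C, G.Adj u w → w ∈ D.bag j ∩ C) →
        Feasible G univ C k (D.lower j ∩ C) (D.bag j ∩ C) (D.rest j ∩ C) (τ.trace C) := by
      intro j τ hj hτ hd
      refine ih j (htrans j hj) _ _ _ _ ⟨rfl, rfl, rfl⟩ (Or.inr ⟨m, τ, hj, hτ, rfl⟩) ?_ hd
      intro p hp hp'
      rw [hp.unique hj] at hp'
      obtain ⟨e1, e2, e3⟩ := hm
      obtain ⟨f1, f2, f3⟩ := hp'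
      exact hchild j hj ⟨f1.symm.trans e1, f2.symm.trans e2, f3.symm.trans e3⟩
    obtain ⟨τ, hτ⟩ := hD.2 m
    have hvalid : IsValid G univ C ⟨τ.trace C, L, X, R, hi⟩ := by
      refine Or.inl ⟨Finset.nonempty_iff_ne_empty.2 hL, htr.isValidPartition, D, hD, m, i, hm, htr,
        fun j hj => ⟨habove j hj, hbelow j hj⟩, ⟨τ, hτ, rfl⟩, hop⟩
    have hloc : loctw G C ⟨τ.trace C, L, X, R, hi⟩ ≤ k :=
      loctw_le hk hm htr (Or.inr ⟨τ, hτ, rfl⟩) hop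
    refine ⟨τ.trace C, hvalid, ?_⟩
    obtain ⟨m1, m2, m3⟩ := hm
    cases τ with
    | introduce u =>
      refine (ptw_introduce_le_iff hL).2 ⟨?_, hloc, ?_⟩
      all_goals
        rcases id hτ with ⟨h1, -⟩ | ⟨j, h1, h2, h3⟩
        · rw [lower_eq_empty h1, Finset.empty_inter] at m1
          exact (hL m1.symm).elim
      all_goals
        have hj := father_of_only h1
        have e1 := introduce_lower h1 h2 h3
        have e2 := introduce_bag h2 h3
        have e3 := introduce_rest h1 h2 h3
        -- Introducing a vertex outside `C` would leave the trace unchanged, against the choice of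
        -- `m` as the lowest node.
        have huC : u ∈ C := by
          by_contra huC
          refine hchild j hj ⟨?_, ?_, ?_⟩
          · rw [e1, m1]
          · rw [e2, Finset.sdiff_inter_right_comm, m2, Finset.sdiff_singleton_eq_erase,
              Finset.erase_eq_of_notMem]
            rw [← m2]
            exact fun h => huC (Finset.mem_inter.1 h).2
          · rw [e3, Finset.union_inter_distrib_right, Finset.singleton_inter_of_notMem huC,
              Finset.union_empty, m3]
      · rw [← m2, h3]
        exact Finset.mem_inter.2 ⟨Finset.mem_insert_self _ _, huC⟩
      · have := hrec j _ hj hτ (fun h => by rw [e1, m1] at h; exact (hL h).elim)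
        rwa [e1, e2, e3, m1, Finset.sdiff_inter_right_comm, m2, Finset.union_inter_distrib_right,
          m3, Finset.singleton_inter_of_mem huC] at this
    | forget u =>
      obtain ⟨j, h1, h2, h3⟩ := id hτ
      have hj := father_of_only h1
      have e1 := forget_lower h1 h2 h3
      have e2 := forget_bag h2 h3
      have e3 := forget_rest h1 h2 h3
      have hul := forget_mem_lower h1 h2 h3
      have huC : u ∈ C := by
        by_contra huC
        refine hchild j hj ⟨?_, ?_, ?_⟩
        · rw [e1, Finset.sdiff_inter_right_comm, m1, Finset.sdiff_singleton_eq_erase,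
            Finset.erase_eq_of_notMem]
          rw [← m1]
          exact fun h => huC (Finset.mem_inter.1 h).2
        · rw [e2, Finset.union_inter_distrib_right, Finset.singleton_inter_of_notMem huC,
            Finset.union_empty, m2]
        · rw [e3, m3]
      refine (ptw_forget_le_iff hL).2 ⟨?_, hloc, ?_⟩
      · rw [← m1]
        exact Finset.mem_inter.2 ⟨hul, huC⟩
      · have := hrec j _ hj hτ ?_
        · rwa [e1, e2, e3, Finset.sdiff_inter_right_comm, m1, Finset.union_inter_distrib_right,
            Finset.singleton_inter_of_mem huC, m2, m3] at this
        -- If forgetting `u` leaves nothing of `C` below, the child is degenerate: `u` is in the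
        -- lower set of `m`, so none of its neighbours is in the rest, and those in `C` can only be
        -- in the bag.
        · intro h
          refine ⟨u, Finset.mem_inter.2 ⟨h2, huC⟩, rfl, fun w hw huw => ?_⟩
          refine Finset.mem_inter.2 ⟨mem_bag_iff_not.2 ⟨fun hwl => ?_, fun hwr => ?_⟩, hw⟩
          · rw [Finset.eq_empty_iff_forall_notMem] at h
            exact h w (Finset.mem_inter.2 ⟨hwl, hw⟩)
          · rw [e3] at hwr
            exact not_adj_of_lower_of_rest hul hwr huw
    | join X' L₁ L₂ =>
      obtain ⟨j, l, hjl, h1, hbj, hbl, rfl, rfl, rfl⟩ := id hτ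
      have h1' : ∀ j', D.Father m j' ↔ j' = l ∨ j' = j := fun j' => (h1 j').trans or_comm
      have hj := join_father_left h1
      have hl := join_father_right h1
      have e0 : L = (D.lower j ∩ C) ∪ (D.lower l ∩ C) := by
        rw [← m1, join_lower h1 hbj hbl, Finset.union_inter_distrib_right]
      have ej : D.rest j ∩ C = R ∪ (D.lower l ∩ C) := by
        rw [join_rest_left hjl h1 hbj hbl, Finset.union_inter_distrib_right, m3]
      have el : D.rest l ∩ C = R ∪ (D.lower j ∩ C) := by
        rw [join_rest_left hjl.symm h1' hbl hbj, Finset.union_inter_distrib_right, m3]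
      -- If one child had no vertex of `C` in its lower set, the other would have the trace of `m`.
      -- So neither child of the join is degenerate and both cardinalities drop.
      have hne : ∀ {a b : D.I}, D.Father m a → D.bag a = D.bag m →
          L = (D.lower a ∩ C) ∪ (D.lower b ∩ C) → D.rest a ∩ C = R ∪ (D.lower b ∩ C) →
          D.lower b ∩ C ≠ ∅ := by
        intro a b ha hba e1 e2 h
        rw [h, Finset.union_empty] at e1 e2
        exact hchild a ha ⟨e1.symm, by rw [hba, m2], e2⟩
      have hl0 := hne hj hbj e0 ej
      have hj0 := hne hl hbl (e0.trans (Finset.union_comm _ _)) el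
      have hcard : L.card = (D.lower j ∩ C).card + (D.lower l ∩ C).card := by
        rw [e0, Finset.card_union_of_disjoint]
        rw [Finset.disjoint_left]
        exact fun w hw hw' => join_notMem_lower hjl h1 hbj (Finset.mem_inter.1 hw).1
          (Finset.mem_inter.1 hw').1
      have c1 := Finset.card_pos.2 (Finset.nonempty_iff_ne_empty.2 hj0)
      have c2 := Finset.card_pos.2 (Finset.nonempty_iff_ne_empty.2 hl0)
      refine (ptw_join_le_iff hL).2 ⟨⟨by omega, by omega⟩, hloc, ?_, ?_⟩
      · have := hrec j _ hj hτ (fun h => (hj0 h).elim)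
        simp only [Op.trace] at this
        rwa [hbj, m2, ej] at this
      · have := hrec l _ hl hτ (fun h => (hl0 h).elim)
        simp only [Op.trace] at this
        rwa [hbl, m2, el] at this

theorem feasible_root (hD : D.IsNice univ) (hk : ∀ i, ((D.bag i).card : ℤ) ≤ k + 1)
    (hmem : univ ∈ C) : Feasible G univ C k (C \ {univ}) {univ} ∅ (.forget univ) := by
  have h1 : D.below D.root = Finset.univ := by
    ext v
    obtain ⟨i, hi⟩ := D.cover v
    simp only [Finset.mem_univ, iff_true]
    exact mem_below.2 ⟨i, above_root i, hi⟩
  refine feasible hD hk D.root _ _ _ _ ⟨?_, ?_, ?_⟩ (Or.inl ⟨rfl, univ, hD.1, rfl⟩)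
    (fun p hp => (not_father_root hp).elim) fun h => ⟨univ, by simp, rfl, fun w hw _ => ?_⟩
  · rw [lower, h1, hD.1]
    ext v
    simp [and_comm]
  · rw [hD.1, Finset.singleton_inter_of_mem hmem]
  · rw [rest_root, Finset.empty_inter]
  · exact Finset.sdiff_eq_empty_iff_subset.1 h hw

end RootedTreeDecomp

end VCTreewidth

/-! ### From quintuples of small partial treewidth to a tree decomposition. -/

namespace VCTreewidth

open BagTree RootedTreeDecomp

variable {V : Type*} [Fintype V] [DecidableEq V] {G : SimpleGraph V} {univ : V} {C : Finset V}
  {k : ℤ}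

/-- `L`, `X`, `R` is a partition of `C`, and `X` separates `L` from `R` in `C`. -/
structure Separates (G : SimpleGraph V) (C L X R : Finset V) : Prop where
  mem_iff : ∀ v, v ∈ C ↔ v ∈ L ∨ v ∈ X ∨ v ∈ R
  left : ∀ v ∈ L, v ∉ X
  left_right : ∀ v ∈ L, v ∉ R
  mid : ∀ v ∈ X, v ∉ R
  not_adj : ∀ u ∈ L, ∀ v ∈ R, ¬ G.Adj u v

theorem IsValidPartition.separates {L X R : Finset V} (h : IsValidPartition G C L X R) :
    Separates G C L X R := by
  obtain ⟨D, i, rfl, rfl, rfl⟩ := h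
  have key : ∀ v, v ∈ D.bag i ↔ v ∉ D.lower i ∧ v ∉ D.rest i := fun v => mem_bag_iff_not
  have hlr : ∀ v, v ∈ D.lower i → v ∉ D.rest i := fun v h1 h2 =>
    mem_rest.1 h2 (mem_lower.1 h1).1
  refine ⟨fun v => ?_, fun v hv hv' => ?_, fun v hv hv' => ?_, fun v hv hv' => ?_,
    fun u hu v hv => ?_⟩
  · have := key v
    simp only [Finset.mem_inter]
    tauto
  · exact ((key v).1 (Finset.mem_inter.1 hv').1).1 (Finset.mem_inter.1 hv).1
  · exact hlr v (Finset.mem_inter.1 hv).1 (Finset.mem_inter.1 hv').1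
  · exact ((key v).1 (Finset.mem_inter.1 hv).1).2 (Finset.mem_inter.1 hv').1
  · exact not_adj_of_lower_of_rest (Finset.mem_inter.1 hu).1 (Finset.mem_inter.1 hv).1

theorem IsValid.separates {Q : Quintuple V} (h : IsValid G univ C Q) :
    Separates G C Q.L Q.X Q.R := by
  rcases h with ⟨-, h, -⟩ | ⟨-, h, -⟩ <;> exact h.separates

/-- The bag of the lowest node with the trace of `Q`. -/
noncomputable def bagLo (G : SimpleGraph V) (C : Finset V) (Q : Quintuple V) : Finset V :=
  Q.X ∪ XTR G C Q ∪ XL G C Q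

/-- The bag of the highest node with the trace of `Q`. -/
noncomputable def bagHi (G : SimpleGraph V) (C : Finset V) (Q : Quintuple V) : Finset V :=
  Q.X ∪ XTR G C Q ∪ XR G C Q

theorem card_bagLo_le {Q : Quintuple V} (h : loctw G C Q ≤ k) :
    ((bagLo G C Q).card : ℤ) ≤ k + 1 := by
  have h1 := (loctw_le_iff.1 h).1
  have h2 := Finset.card_union_le (Q.X ∪ XTR G C Q) (XL G C Q)
  have h3 := Finset.card_union_le Q.X (XTR G C Q)
  unfold bagLo
  omega

theorem card_bagHi_le {Q : Quintuple V} (h : loctw G C Q ≤ k) :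
    ((bagHi G C Q).card : ℤ) ≤ k + 1 := by
  have h1 := (loctw_le_iff.1 h).2.1
  have h2 := Finset.card_union_le (Q.X ∪ XTR G C Q) (XR G C Q)
  have h3 := Finset.card_union_le Q.X (XTR G C Q)
  unfold bagHi
  omega

theorem card_X_le {Q : Quintuple V} (h : loctw G C Q ≤ k) : (Q.X.card : ℤ) ≤ k + 1 := by
  have := (loctw_le_iff.1 h).1
  omega

/-- `t` is a tree decomposition, with bags of size at most `k + 1`, of the part of the graph that
lies below a node with the trace of `Q`. The vertices `x ∉ C` without neighbours in `L` are not in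
`t`. -/
structure PreRealizes (G : SimpleGraph V) (C : Finset V) (k : ℤ) (Q : Quintuple V)
    (t : BagTree V) : Prop where
  conn : t.Conn
  card_le : ∀ c, t.HasBag c → (c.card : ℤ) ≤ k + 1
  X_subset : Q.X ⊆ t.top
  XTR_subset : XTR G C Q ⊆ t.top
  verts_mem : ∀ v ∈ C, t.Verts v ↔ v ∈ Q.L ∨ v ∈ Q.X
  verts_notMem : ∀ x ∉ C, t.Verts x ↔ ∃ w ∈ Q.L, G.Adj x w
  -- An edge inside `X` is not required yet: it is covered when its first endpoint is forgotten and
  -- moves to `L`.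
  edge_mem : ∀ w ∈ Q.L, ∀ w', w' ∈ Q.L ∨ w' ∈ Q.X → G.Adj w w' →
    ∃ c, t.HasBag c ∧ w ∈ c ∧ w' ∈ c
  edge_lower : ∀ x ∉ C, ∀ w ∈ Q.L, G.Adj x w → ∃ c, t.HasBag c ∧ x ∈ c ∧ w ∈ c
  -- Only vertices without neighbours in `R` need this: the others are in `XTR` and share the root
  -- bag with `X`.
  edge_bag : ∀ x ∉ C, (∃ w ∈ Q.L, G.Adj x w) → (∀ w ∈ Q.R, ¬ G.Adj x w) →
    ∀ w ∈ Q.X, G.Adj x w → ∃ c, t.HasBag c ∧ x ∈ c ∧ w ∈ c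

/-- A variant of `PreRealizes` in which the root bag is `bagHi G C Q`. -/
structure Realizes (G : SimpleGraph V) (C : Finset V) (k : ℤ) (Q : Quintuple V)
    (t : BagTree V) : Prop where
  conn : t.Conn
  card_le : ∀ c, t.HasBag c → (c.card : ℤ) ≤ k + 1
  top_eq : t.top = bagHi G C Q
  verts_mem : ∀ v ∈ C, t.Verts v ↔ v ∈ Q.L ∨ v ∈ Q.X
  verts_notMem : ∀ x ∉ C, t.Verts x ↔ (∃ w ∈ Q.L, G.Adj x w) ∨ x ∈ XR G C Q
  edge_mem : ∀ w ∈ Q.L, ∀ w', w' ∈ Q.L ∨ w' ∈ Q.X → G.Adj w w' →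
    ∃ c, t.HasBag c ∧ w ∈ c ∧ w' ∈ c
  edge_lower : ∀ x ∉ C, ∀ w ∈ Q.L, G.Adj x w → ∃ c, t.HasBag c ∧ x ∈ c ∧ w ∈ c
  edge_bag : ∀ x ∉ C, (∃ w ∈ Q.L, G.Adj x w) → (∀ w ∈ Q.R, ¬ G.Adj x w) →
    ∀ w ∈ Q.X, G.Adj x w → ∃ c, t.HasBag c ∧ x ∈ c ∧ w ∈ c

theorem mem_bagHi {Q : Quintuple V} {v : V} :
    v ∈ bagHi G C Q ↔ v ∈ Q.X ∨ v ∈ XTR G C Q ∨ v ∈ XR G C Q := by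
  rw [bagHi, Finset.mem_union, Finset.mem_union, or_assoc]

theorem mem_bagLo {Q : Quintuple V} {v : V} :
    v ∈ bagLo G C Q ↔ v ∈ Q.X ∨ v ∈ XTR G C Q ∨ v ∈ XL G C Q := by
  rw [bagLo, Finset.mem_union, Finset.mem_union, or_assoc]

theorem mem_XR {Q : Quintuple V} {x : V} : x ∈ XR G C Q ↔ x ∉ C ∧
    (∃ v, Q.hi = .forget v ∧ G.Adj x v) ∧ (∀ w, G.Adj x w → w ∈ Q.R ∨ w ∈ Q.X) ∧
      ∃ w ∈ Q.R, G.Adj x w := by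
  constructor
  · intro hx
    obtain ⟨v, hv⟩ := exists_of_mem_XR hx
    obtain ⟨h1, h2, h3, h4⟩ := (mem_XR_forget hv).1 hx
    exact ⟨h1, ⟨v, hv, h3⟩, fun w hw => Finset.mem_union.1 (h2 w hw), h4⟩
  · rintro ⟨h1, ⟨v, hv, h3⟩, h2, h4⟩
    exact (mem_XR_forget hv).2 ⟨h1, fun w hw => Finset.mem_union.2 (h2 w hw), h3, h4⟩

/-- Adding `bagHi` on top keeps connectedness: `X` and `XTR` are already in the root bag, and the
vertices of `XR` have no neighbour in `L`, hence are new. -/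
theorem PreRealizes.realizes {Q : Quintuple V} {t : BagTree V} (ht : PreRealizes G C k Q t)
    (hQ : Separates G C Q.L Q.X Q.R) (hk : loctw G C Q ≤ k) :
    Realizes G C k Q (un (bagHi G C Q) t) := by
  have hXC : ∀ v ∈ Q.X, v ∈ C := fun v hv => (hQ.mem_iff v).2 (Or.inr (Or.inl hv))
  have hXR : ∀ x ∈ XR G C Q, ∀ w ∈ Q.L, ¬ G.Adj x w := by
    intro x hx w hw hxw
    rcases (mem_XR.1 hx).2.2.1 w hxw with h | h
    · exact hQ.left_right w hw h
    · exact hQ.left w hw h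
  refine ⟨⟨ht.conn, fun v hv hvt => ?_⟩, ?_, rfl, fun v hv => ?_, fun x hx => ?_, ?_, ?_, ?_⟩
  · rcases mem_bagHi.1 hv with h | h | h
    · exact ht.X_subset h
    · exact ht.XTR_subset h
    · obtain ⟨w, hw, hxw⟩ := (ht.verts_notMem v (mem_XR.1 h).1).1 hvt
      exact (hXR v h w hw hxw).elim
  · rintro c (rfl | hc)
    · exact card_bagHi_le hk
    · exact ht.card_le c hc
  · rw [verts_un, mem_bagHi, mem_XTR, mem_XR, ht.verts_mem v hv]
    tauto
  · rw [verts_un, mem_bagHi, mem_XTR, ht.verts_notMem x hx]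
    have := hXC x
    generalize (∃ w ∈ Q.L, G.Adj x w) = p
    generalize (∃ w ∈ Q.R, G.Adj x w) = q
    tauto
  · intro w hw w' hw' h
    obtain ⟨c, hc, h⟩ := ht.edge_mem w hw w' hw' h
    exact ⟨c, Or.inr hc, h⟩
  · intro x hx w hw h
    obtain ⟨c, hc, h⟩ := ht.edge_lower x hx w hw h
    exact ⟨c, Or.inr hc, h⟩
  · intro x hx h1 h2 w hw h
    obtain ⟨c, hc, h⟩ := ht.edge_bag x hx h1 h2 w hw h
    exact ⟨c, Or.inr hc, h⟩

/-- Attaching leaves for vertices with all neighbours in the root bag. -/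
theorem exists_attach {t : BagTree V} (hconn : t.Conn)
    (hcard : ∀ c, t.HasBag c → (c.card : ℤ) ≤ k + 1) (P : Finset V)
    (hP : ∀ x ∈ P, ¬ t.Verts x ∧
      ∃ b ⊆ t.top, (∀ w, G.Adj x w → w ∈ b) ∧ ((insert x b).card : ℤ) ≤ k + 1) :
    ∃ t' : BagTree V, t'.Conn ∧ (∀ c, t'.HasBag c → (c.card : ℤ) ≤ k + 1) ∧ t'.top = t.top ∧
      (∀ v, t'.Verts v ↔ v ∈ P ∨ t.Verts v) ∧ (∀ c, t.HasBag c → t'.HasBag c) ∧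
      ∀ x ∈ P, ∀ w, G.Adj x w → ∃ c, t'.HasBag c ∧ x ∈ c ∧ w ∈ c := by
  induction P using Finset.induction_on with
  | empty => exact ⟨t, hconn, hcard, rfl, by simp, fun _ h => h, by simp⟩
  | insert x P hxP ih =>
    obtain ⟨t', h1, h2, h3, h4, h5, h6⟩ := ih fun y hy => hP y (Finset.mem_insert_of_mem hy)
    obtain ⟨hx, b, hb, hN, hbk⟩ := hP x (Finset.mem_insert_self x P)
    have hx' : ¬ t'.Verts x := by rw [h4]; exact not_or.2 ⟨hxP, hx⟩
    refine ⟨bin t.top t' (leaf (insert x b)), ⟨h1, trivial, fun v hv _ => h3 ▸ hv,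
      fun v _ hv => by simpa [top] using hv, fun v hv hv' => ?_⟩, ?_, rfl, fun v => ?_,
      fun c hc => Or.inr (Or.inl (h5 c hc)), ?_⟩
    · rcases Finset.mem_insert.1 (verts_leaf.1 hv') with rfl | hv'
      · exact (hx' hv).elim
      · exact hb hv'
    · rintro c (rfl | hc | rfl)
      · exact hcard _ t.hasBag_top
      · exact h2 c hc
      · exact hbk
    · have e1 := verts_of_mem_top (t := t) (v := v)
      have e2 := @hb v
      rw [verts_bin, h4, verts_leaf, Finset.mem_insert, Finset.mem_insert]
      tauto
    · intro y hy w hw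
      rcases Finset.mem_insert.1 hy with rfl | hy
      · exact ⟨_, Or.inr (Or.inr rfl), Finset.mem_insert_self _ _,
          Finset.mem_insert_of_mem (hN w hw)⟩
      · obtain ⟨c, hc, h⟩ := h6 y hy w hw
        exact ⟨c, Or.inr (Or.inl hc), h⟩

/-- The leaf bag for a vertex with neighbourhood in `X` is not too large. -/
theorem exists_leaf_bag {Q : Quintuple V} (hk : loctw G C Q ≤ k) {x : V} (hx : x ∉ C)
    (hN : ∀ w, G.Adj x w → w ∈ Q.X) :
    ∃ b ⊆ Q.X, (∀ w, G.Adj x w → w ∈ b) ∧ ((insert x b).card : ℤ) ≤ k + 1 := by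
  classical
  refine ⟨Q.X.filter fun w => G.Adj x w, Finset.filter_subset _ _,
    fun w hw => Finset.mem_filter.2 ⟨hN w hw, hw⟩, ?_⟩
  have h0 := Finset.card_insert_le x (Q.X.filter fun w => G.Adj x w)
  obtain ⟨h1, -, h3⟩ := loctw_le_iff.1 hk
  -- If the neighbourhood is all of `X`, then `ε = 1` pays for `x`; otherwise it is a proper subset
  -- and adding `x` gives at most `|X|` vertices.
  by_cases h : ∀ w ∈ Q.X, G.Adj x w
  · have he : eps G C Q = 1 := if_pos ⟨x, hx, fun w => ⟨hN w, h w⟩⟩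
    have := Finset.card_le_card (Finset.filter_subset (fun w => G.Adj x w) Q.X)
    omega
  · have := Finset.card_lt_card ((Finset.filter_ssubset (p := fun w => G.Adj x w)).2
      (by push Not at h; exact h))
    omega

theorem preRealizes_leaf {Q : Quintuple V} (hQ : Separates G C Q.L Q.X Q.R) (hL : Q.L = ∅)
    (hk : loctw G C Q ≤ k) : PreRealizes G C k Q (leaf Q.X) := by
  have hXC : ∀ v ∈ Q.X, v ∈ C := fun v hv => (hQ.mem_iff v).2 (Or.inr (Or.inl hv))
  refine ⟨trivial, ?_, subset_rfl, ?_, ?_, ?_, ?_, ?_, ?_⟩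
  · rintro c rfl
    exact card_X_le hk
  · intro x hx
    obtain ⟨-, ⟨w, hw, -⟩, -⟩ := mem_XTR.1 hx
    simp [hL] at hw
  · simp [hL]
  · intro x hx
    simp only [verts_leaf, hL, Finset.notMem_empty, false_and, exists_false, iff_false]
    exact fun h => hx (hXC x h)
  all_goals simp [hL]

/-- For the child, `u` belongs to the rest. Its `XTR` is therefore `XTR ∪ XL` of the present
quintuple, and its `XR` is empty, so `bagLo` is the root bag of `t` with `u` added. -/
theorem PreRealizes.introduce {L X R : Finset V} {hi τ : Op V} {u : V} {t : BagTree V}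
    (hC : ∀ x ∉ C, ∀ w, G.Adj x w → w ∈ C) (hL : L ≠ ∅) (hu : u ∈ X)
    (hQ : Separates G C L X R) (hQ' : Separates G C L (X \ {u}) (R ∪ {u}))
    (hk : loctw G C ⟨.introduce u, L, X, R, hi⟩ ≤ k)
    (ht : Realizes G C k ⟨τ, L, X \ {u}, R ∪ {u}, .introduce u⟩ t) :
    PreRealizes G C k ⟨.introduce u, L, X, R, hi⟩
      (un (bagLo G C ⟨.introduce u, L, X, R, hi⟩) t) := by
  have huC : u ∈ C := (hQ.mem_iff u).2 (Or.inr (Or.inl hu))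
  have hLC : ∀ v ∈ L, v ∈ C := fun v hv => (hQ.mem_iff v).2 (Or.inl hv)
  have hXC : ∀ v ∈ X, v ∈ C := fun v hv => (hQ.mem_iff v).2 (Or.inr (Or.inl hv))
  have hXR : ∀ x, x ∉ XR G C ⟨τ, L, X \ {u}, R ∪ {u}, .introduce u⟩ := fun x hx => by
    obtain ⟨v, hv⟩ := exists_of_mem_XR hx
    cases hv
  have hlo : ∀ x, x ∈ bagLo G C ⟨.introduce u, L, X, R, hi⟩ ↔ x = u ∨ x ∈ t.top := by
    intro x
    rw [ht.top_eq, mem_bagHi, mem_bagLo, mem_XTR, mem_XTR, mem_XL_introduce hL rfl]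
    simp only [Finset.mem_sdiff, Finset.mem_singleton, Finset.mem_union, hXR, or_false]
    constructor
    · rintro (h | ⟨h1, h2, w, hw, hxw⟩ | ⟨h1, h2, h3, h4⟩)
      · tauto
      · exact Or.inr (Or.inr ⟨h1, h2, w, Or.inl hw, hxw⟩)
      · exact Or.inr (Or.inr ⟨h1, h4, u, Or.inr rfl, h3⟩)
    · rintro (rfl | h | ⟨h1, h2, w, hw | rfl, hxw⟩)
      · exact Or.inl hu
      · exact Or.inl h.1
      · exact Or.inr (Or.inl ⟨h1, h2, w, hw, hxw⟩)
      · by_cases hR : ∃ w ∈ R, G.Adj x w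
        · exact Or.inr (Or.inl ⟨h1, h2, hR⟩)
        · refine Or.inr (Or.inr ⟨h1, fun w' hw' => ?_, hxw, h2⟩)
          rcases (hQ.mem_iff w').1 (hC x h1 w' hw') with h | h | h
          · exact Or.inl h
          · exact Or.inr h
          · exact (hR ⟨w', h, hw'⟩).elim
  have hut : ¬ t.Verts u := by
    rw [ht.verts_mem u huC]
    have := hQ.left u
    simp
    tauto
  refine ⟨⟨ht.conn, fun v hv hvt => ?_⟩, ?_, ?_, ?_, ?_, ?_, ?_, ?_, ?_⟩
  · rcases (hlo v).1 hv with rfl | h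
    · exact (hut hvt).elim
    · exact h
  · rintro c (rfl | hc)
    · exact card_bagLo_le hk
    · exact ht.card_le c hc
  · exact fun v hv => mem_bagLo.2 (Or.inl hv)
  · exact fun v hv => mem_bagLo.2 (Or.inr (Or.inl hv))
  · intro v hv
    have e := verts_of_mem_top (t := t) (v := v)
    rw [verts_un, hlo, or_assoc, or_iff_right_of_imp e, ht.verts_mem v hv]
    simp only [Finset.mem_sdiff, Finset.mem_singleton]
    by_cases hvu : v = u
    · subst hvu; tauto
    · tauto
  · intro x hx
    have e := verts_of_mem_top (t := t) (v := x)
    have hxu : x ≠ u := fun h => hx (h ▸ huC)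
    rw [verts_un, hlo, or_assoc, or_iff_right_of_imp e, ht.verts_notMem x hx]
    simp only [hxu, hXR, false_or, or_false]
  · intro w hw w' hw' hww'
    have hwu : w' ≠ u := by
      rintro rfl
      exact hQ'.not_adj w hw w' (by simp) hww'
    obtain ⟨c, hc, h⟩ := ht.edge_mem w hw w' (by
      simp only [Finset.mem_sdiff, Finset.mem_singleton]; tauto) hww'
    exact ⟨c, Or.inr hc, h⟩
  · intro x hx w hw hxw
    obtain ⟨c, hc, h⟩ := ht.edge_lower x hx w hw hxw
    exact ⟨c, Or.inr hc, h⟩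
  · intro x hx hl hr w hw hxw
    by_cases hxu : G.Adj x u
    -- Such an `x` has `u` as its last neighbour to be introduced, so it is in `XL` and meets all of
    -- `X` in the new bag.
    · refine ⟨_, Or.inl rfl, mem_bagLo.2 (Or.inr (Or.inr ?_)), mem_bagLo.2 (Or.inl hw)⟩
      rw [mem_XL_introduce hL rfl]
      refine ⟨hx, fun w' hw' => ?_, hxu, hl⟩
      rcases (hQ.mem_iff w').1 (hC x hx w' hw') with h | h | h
      · exact Finset.mem_union_left _ h
      · exact Finset.mem_union_right _ h
      · exact (hr w' h hw').elim
    · obtain ⟨c, hc, h⟩ := ht.edge_bag x hx hl (by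
        intro w' hw'
        rcases Finset.mem_union.1 hw' with h | h
        · exact hr w' h
        · rw [Finset.mem_singleton.1 h]; exact hxu) w (by
        simp only [Finset.mem_sdiff, Finset.mem_singleton]
        refine ⟨hw, ?_⟩
        rintro rfl
        exact hxu hxw) hxw
      exact ⟨c, Or.inr hc, h⟩

/-- When `u` is forgotten, all its edges must be covered. A neighbour `x ∉ C` is already in `t` if
it also has a neighbour in `L \ {u}`; if not, it is in `XR` of the child when it has a neighbour in
`R`, and is attached as a leaf when all its neighbours are in `X ∪ {u}`. The root bag is not shrunk
here: `u` disappears when `bagHi` is put on top. -/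
theorem exists_preRealizes_forget {L X R : Finset V} {hi τ : Op V} {u : V} {t : BagTree V}
    (hC : ∀ x ∉ C, ∀ w, G.Adj x w → w ∈ C) (hu : u ∈ L)
    (hQ : Separates G C L X R) (hQ' : Separates G C (L \ {u}) (X ∪ {u}) R)
    (hk : loctw G C ⟨τ, L \ {u}, X ∪ {u}, R, .forget u⟩ ≤ k)
    (ht : Realizes G C k ⟨τ, L \ {u}, X ∪ {u}, R, .forget u⟩ t) :
    ∃ t', PreRealizes G C k ⟨.forget u, L, X, R, hi⟩ t' := by
  classical
  have huC : u ∈ C := (hQ.mem_iff u).2 (Or.inl hu)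
  have hXC : ∀ v ∈ X ∪ {u}, v ∈ C := fun v hv => (hQ'.mem_iff v).2 (Or.inr (Or.inl hv))
  have hmid : X ∪ {u} ⊆ t.top := fun v hv => by
    rw [ht.top_eq, mem_bagHi]
    exact Or.inl hv
  have hut : u ∈ t.top := hmid (by simp)
  obtain ⟨t', h1, h2, h3, h4, h5, h6⟩ := exists_attach (G := G) ht.conn ht.card_le
    (Finset.univ.filter fun x => x ∉ C ∧ G.Adj x u ∧ ∀ w, G.Adj x w → w ∈ X ∪ {u}) (by
      intro x hx
      simp only [Finset.mem_filter, Finset.mem_univ, true_and] at hx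
      obtain ⟨hxC, hxu, hN⟩ := hx
      constructor
      · rw [ht.verts_notMem x hxC, mem_XR]
        rintro (⟨w, hw, hxw⟩ | ⟨-, -, -, w, hw, hxw⟩)
        · exact hQ'.left w hw (hN w hxw)
        · exact hQ'.mid w (hN w hxw) hw
      · obtain ⟨b, hb, hb'⟩ := exists_leaf_bag hk hxC hN
        exact ⟨b, hb.trans hmid, hb'⟩)
  simp only [Finset.mem_filter, Finset.mem_univ, true_and] at h4 h6
  have hcases : ∀ x ∉ C, G.Adj x u → (∃ w ∈ L \ {u}, G.Adj x w) ∨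
      ((∃ w ∈ R, G.Adj x w) ∧ x ∈ XR G C ⟨τ, L \ {u}, X ∪ {u}, R, .forget u⟩) ∨
      ∀ w, G.Adj x w → w ∈ X ∪ {u} := by
    intro x hx hxu
    by_cases hl : ∃ w ∈ L \ {u}, G.Adj x w
    · exact Or.inl hl
    have hN : ∀ w, G.Adj x w → w ∈ R ∨ w ∈ X ∪ {u} := by
      intro w hw
      rcases (hQ'.mem_iff w).1 (hC x hx w hw) with h | h | h
      · exact (hl ⟨w, h, hw⟩).elim
      · exact Or.inr h
      · exact Or.inl h
    by_cases hr : ∃ w ∈ R, G.Adj x w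
    · exact Or.inr (Or.inl ⟨hr, mem_XR.2 ⟨hx, ⟨u, rfl, hxu⟩, hN, hr⟩⟩)
    · refine Or.inr (Or.inr fun w hw => (hN w hw).resolve_left fun h => hr ⟨w, h, hw⟩)
  have hpush : ∀ {a b : V}, (∃ c, t.HasBag c ∧ a ∈ c ∧ b ∈ c) →
      ∃ c, t'.HasBag c ∧ a ∈ c ∧ b ∈ c := fun ⟨c, hc, h⟩ => ⟨c, h5 c hc, h⟩
  have htop : ∀ {a b : V}, a ∈ t.top → b ∈ t.top → ∃ c, t'.HasBag c ∧ a ∈ c ∧ b ∈ c :=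
    fun ha hb => hpush ⟨_, t.hasBag_top, ha, hb⟩
  have hsplit : ∀ x, (∃ w ∈ L, G.Adj x w) → (∃ w ∈ L \ {u}, G.Adj x w) ∨ G.Adj x u := by
    rintro x ⟨w, hw, hxw⟩
    by_cases hwu : w = u
    · exact Or.inr (hwu ▸ hxw)
    · exact Or.inl ⟨w, by simp [hw, hwu], hxw⟩
  have hback : ∀ x, (∃ w ∈ L \ {u}, G.Adj x w) → ∃ w ∈ L, G.Adj x w := by
    rintro x ⟨w, hw, hxw⟩
    exact ⟨w, (Finset.mem_sdiff.1 hw).1, hxw⟩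
  have hXTR : ∀ x, x ∉ C → (∃ w ∈ L \ {u}, G.Adj x w) → (∃ w ∈ R, G.Adj x w) → x ∈ t.top := by
    intro x hx hl hr
    rw [ht.top_eq, mem_bagHi]
    exact Or.inr (Or.inl (mem_XTR.2 ⟨hx, hl, hr⟩))
  have hXR : ∀ x ∈ XR G C ⟨τ, L \ {u}, X ∪ {u}, R, .forget u⟩, x ∈ t.top := by
    intro x hx
    rw [ht.top_eq, mem_bagHi]
    exact Or.inr (Or.inr hx)
  refine ⟨t', h1, h2, ?_, ?_, ?_, ?_, ?_, ?_, ?_⟩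
  · rw [h3]
    exact fun v hv => hmid (Finset.mem_union_left _ hv)
  · intro x hx
    obtain ⟨hxC, hl, hr⟩ := mem_XTR.1 hx
    rw [h3]
    rcases hsplit x hl with hl' | hxu
    · exact hXTR x hxC hl' hr
    · rcases hcases x hxC hxu with h | h | h
      · exact hXTR x hxC h hr
      · exact hXR x h.2
      · obtain ⟨w, hw, hxw⟩ := hr
        exact (hQ'.mid w (h w hxw) hw).elim
  · intro v hv
    rw [h4, ht.verts_mem v hv]
    simp only [Finset.mem_sdiff, Finset.mem_singleton, Finset.mem_union]
    by_cases hvu : v = u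
    · subst hvu; tauto
    · tauto
  · intro x hx
    rw [h4, ht.verts_notMem x hx]
    constructor
    · rintro (⟨-, hxu, -⟩ | hl | h)
      · exact ⟨u, hu, hxu⟩
      · exact hback x hl
      · obtain ⟨-, ⟨v, hv, hxv⟩, -⟩ := mem_XR.1 h
        cases hv
        exact ⟨u, hu, hxv⟩
    · intro hl
      rcases hsplit x hl with hl' | hxu
      · exact Or.inr (Or.inl hl')
      · rcases hcases x hx hxu with h | h | h
        · exact Or.inr (Or.inl h)
        · exact Or.inr (Or.inr h.2)
        · exact Or.inl ⟨hx, hxu, h⟩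
  · intro w hw w' hw' hww'
    by_cases hwu : w = u
    · subst hwu
      by_cases hw'X : w' ∈ X
      · exact htop hut (hmid (Finset.mem_union_left _ hw'X))
      · have hw'L : w' ∈ L \ {w} := by
          simp only [Finset.mem_sdiff, Finset.mem_singleton]
          exact ⟨hw'.resolve_right hw'X, hww'.ne'⟩
        obtain ⟨c, hc, h, h'⟩ := ht.edge_mem w' hw'L w (Or.inr (by simp)) hww'.symm
        exact ⟨c, h5 c hc, h', h⟩
    · refine hpush (ht.edge_mem w (by simp [hw, hwu]) w' ?_ hww')
      simp only [Finset.mem_sdiff, Finset.mem_singleton, Finset.mem_union]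
      tauto
  · intro x hx w hw hxw
    by_cases hwu : w = u
    · subst hwu
      rcases hcases x hx hxw with h | h | h
      · by_cases hr : ∃ w ∈ R, G.Adj x w
        · exact htop (hXTR x hx h hr) hut
        · push Not at hr
          exact hpush (ht.edge_bag x hx h hr w (by simp) hxw)
      · exact htop (hXR x h.2) hut
      · exact h6 x ⟨hx, hxw, h⟩ w hxw
    · exact hpush (ht.edge_lower x hx w (by simp [hw, hwu]) hxw)
  · intro x hx hl hr w hw hxw
    have hbag : (∃ w ∈ L \ {u}, G.Adj x w) → ∃ c, t'.HasBag c ∧ x ∈ c ∧ w ∈ c := fun h =>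
      hpush (ht.edge_bag x hx h hr w (Finset.mem_union_left _ hw) hxw)
    rcases hsplit x hl with hl' | hxu
    · exact hbag hl'
    · rcases hcases x hx hxu with h | ⟨⟨w', hw', hxw'⟩, -⟩ | h
      · exact hbag h
      · exact (hr w' hw' hxw').elim
      · exact h6 x ⟨hx, hxu, h⟩ w hxw

/-- Besides `X`, the bag `bagLo` consists of the vertices outside `C` with neighbours in at least
two of `L₁`, `L₂`, `R`. The root bag of each piece contains those among them that occur in that
piece, and a vertex outside `C` occurring in both pieces has neighbours in both `L₁` and `L₂`. -/
theorem PreRealizes.join {L X R X' L₁ L₂ : Finset V} {hi τ₁ τ₂ : Op V} {t₁ t₂ : BagTree V}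
    (hL : L ≠ ∅) (hQ : Separates G C L X R)
    (hQ₁ : Separates G C L₁ X (R ∪ L₂)) (hQ₂ : Separates G C L₂ X (R ∪ L₁))
    (hk : loctw G C ⟨.join X' L₁ L₂, L, X, R, hi⟩ ≤ k)
    (ht₁ : Realizes G C k ⟨τ₁, L₁, X, R ∪ L₂, .join X L₁ L₂⟩ t₁)
    (ht₂ : Realizes G C k ⟨τ₂, L₂, X, R ∪ L₁, .join X L₁ L₂⟩ t₂) :
    PreRealizes G C k ⟨.join X' L₁ L₂, L, X, R, hi⟩
      (bin (bagLo G C ⟨.join X' L₁ L₂, L, X, R, hi⟩) t₁ t₂) := by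
  -- This is recovered by comparing the three partitions of `C`.
  have hL_iff : ∀ v, v ∈ L ↔ v ∈ L₁ ∨ v ∈ L₂ := by
    intro v
    constructor
    · intro hv
      rcases (hQ₁.mem_iff v).1 ((hQ.mem_iff v).2 (Or.inl hv)) with h | h | h
      · exact Or.inl h
      · exact (hQ.left v hv h).elim
      · exact Or.inr ((Finset.mem_union.1 h).resolve_left (hQ.left_right v hv))
    · rintro (hv | hv)
      · rcases (hQ.mem_iff v).1 ((hQ₁.mem_iff v).2 (Or.inl hv)) with h | h | h
        · exact h
        · exact (hQ₁.left v hv h).elim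
        · exact (hQ₁.left_right v hv (Finset.mem_union_left _ h)).elim
      · rcases (hQ.mem_iff v).1 ((hQ₂.mem_iff v).2 (Or.inl hv)) with h | h | h
        · exact h
        · exact (hQ₂.left v hv h).elim
        · exact (hQ₂.left_right v hv (Finset.mem_union_left _ h)).elim
  have hl_iff : ∀ x, (∃ w ∈ L, G.Adj x w) ↔ (∃ w ∈ L₁, G.Adj x w) ∨ ∃ w ∈ L₂, G.Adj x w := by
    intro x
    simp only [hL_iff, or_and_right, exists_or]
  have hXR₁ : ∀ x, x ∉ XR G C ⟨τ₁, L₁, X, R ∪ L₂, .join X L₁ L₂⟩ := fun x hx => by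
    obtain ⟨v, hv⟩ := exists_of_mem_XR hx
    cases hv
  have hXR₂ : ∀ x, x ∉ XR G C ⟨τ₂, L₂, X, R ∪ L₁, .join X L₁ L₂⟩ := fun x hx => by
    obtain ⟨v, hv⟩ := exists_of_mem_XR hx
    cases hv
  have hXC : ∀ v ∈ X, v ∈ C := fun v hv => (hQ.mem_iff v).2 (Or.inr (Or.inl hv))
  have hLC : ∀ v ∈ L, v ∈ C := fun v hv => (hQ.mem_iff v).2 (Or.inl hv)
  have htop₁ : ∀ v, v ∈ t₁.top ↔ v ∈ X ∨ v ∉ C ∧ (∃ w ∈ L₁, G.Adj v w) ∧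
      ((∃ w ∈ R, G.Adj v w) ∨ ∃ w ∈ L₂, G.Adj v w) := by
    intro v
    rw [ht₁.top_eq, mem_bagHi, mem_XTR]
    simp only [hXR₁, or_false, Finset.mem_union, or_and_right, exists_or]
  have htop₂ : ∀ v, v ∈ t₂.top ↔ v ∈ X ∨ v ∉ C ∧ (∃ w ∈ L₂, G.Adj v w) ∧
      ((∃ w ∈ R, G.Adj v w) ∨ ∃ w ∈ L₁, G.Adj v w) := by
    intro v
    rw [ht₂.top_eq, mem_bagHi, mem_XTR]
    simp only [hXR₂, or_false, Finset.mem_union, or_and_right, exists_or]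
  have hv₁ : ∀ x ∉ C, t₁.Verts x ↔ ∃ w ∈ L₁, G.Adj x w := by
    intro x hx
    rw [ht₁.verts_notMem x hx]
    simp only [hXR₁, or_false]
  have hv₂ : ∀ x ∉ C, t₂.Verts x ↔ ∃ w ∈ L₂, G.Adj x w := by
    intro x hx
    rw [ht₂.verts_notMem x hx]
    simp only [hXR₂, or_false]
  have hlo : ∀ x, x ∈ bagLo G C ⟨.join X' L₁ L₂, L, X, R, hi⟩ ↔ x ∈ X ∨ x ∉ C ∧
      (((∃ w ∈ L₁, G.Adj x w) ∨ ∃ w ∈ L₂, G.Adj x w) ∧ (∃ w ∈ R, G.Adj x w) ∨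
        (∃ w ∈ L₁, G.Adj x w) ∧ ∃ w ∈ L₂, G.Adj x w) := by
    intro x
    rw [mem_bagLo, mem_XTR, mem_XL_join hL rfl, hl_iff]
    have : (∀ w ∈ R, ¬ G.Adj x w) ↔ ¬ ∃ w ∈ R, G.Adj x w := by push Not; rfl
    simp only [this]
    generalize (∃ w ∈ R, G.Adj x w) = p
    generalize (∃ w ∈ L₁, G.Adj x w) = q
    generalize (∃ w ∈ L₂, G.Adj x w) = r
    clear * -
    tauto
  have hpush₁ : ∀ {a b : V}, (∃ c, t₁.HasBag c ∧ a ∈ c ∧ b ∈ c) → ∃ c,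
      (bin (bagLo G C ⟨.join X' L₁ L₂, L, X, R, hi⟩) t₁ t₂).HasBag c ∧ a ∈ c ∧ b ∈ c :=
    fun ⟨c, hc, h⟩ => ⟨c, Or.inr (Or.inl hc), h⟩
  have hpush₂ : ∀ {a b : V}, (∃ c, t₂.HasBag c ∧ a ∈ c ∧ b ∈ c) → ∃ c,
      (bin (bagLo G C ⟨.join X' L₁ L₂, L, X, R, hi⟩) t₁ t₂).HasBag c ∧ a ∈ c ∧ b ∈ c :=
    fun ⟨c, hc, h⟩ => ⟨c, Or.inr (Or.inr hc), h⟩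
  refine ⟨⟨ht₁.conn, ht₂.conn, fun v hv hvt => ?_, fun v hv hvt => ?_, fun v hvt hvt' => ?_⟩,
    ?_, ?_, ?_, ?_, ?_, ?_, ?_, ?_⟩
  · rw [hlo] at hv
    rw [htop₁]
    rcases hv with hv | ⟨hvC, hv⟩
    · exact Or.inl hv
    · rw [hv₁ v hvC] at hvt
      exact Or.inr ⟨hvC, hvt, hv.imp And.right And.right⟩
  · rw [hlo] at hv
    rw [htop₂]
    rcases hv with hv | ⟨hvC, hv⟩
    · exact Or.inl hv
    · rw [hv₂ v hvC] at hvt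
      exact Or.inr ⟨hvC, hvt, hv.imp And.right And.left⟩
  · rw [hlo]
    by_cases hvC : v ∈ C
    · left
      rw [ht₁.verts_mem v hvC] at hvt
      rw [ht₂.verts_mem v hvC] at hvt'
      rcases hvt with h | h
      · rcases hvt' with h' | h'
        · exact (hQ₁.left_right v h (Finset.mem_union_right _ h')).elim
        · exact h'
      · exact h
    · exact Or.inr ⟨hvC, Or.inr ⟨(hv₁ v hvC).1 hvt, (hv₂ v hvC).1 hvt'⟩⟩
  · rintro c (rfl | hc | hc)
    · exact card_bagLo_le hk
    · exact ht₁.card_le c hc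
    · exact ht₂.card_le c hc
  · exact fun v hv => mem_bagLo.2 (Or.inl hv)
  · exact fun v hv => mem_bagLo.2 (Or.inr (Or.inl hv))
  · intro v hv
    rw [verts_bin, hlo, ht₁.verts_mem v hv, ht₂.verts_mem v hv, hL_iff]
    clear * - hv
    tauto
  · intro x hx
    have := hXC x
    rw [verts_bin, hlo, hv₁ x hx, hv₂ x hx, hl_iff]
    generalize (∃ w ∈ R, G.Adj x w) = p
    generalize (∃ w ∈ L₁, G.Adj x w) = q
    generalize (∃ w ∈ L₂, G.Adj x w) = r
    clear * - this hx
    tauto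
  · intro w hw w' hw' hww'
    simp only [hL_iff] at hw hw'
    have hn : ∀ {a b : V}, a ∈ L₁ → b ∈ L₂ → ¬ G.Adj a b := fun ha hb =>
      hQ₁.not_adj _ ha _ (Finset.mem_union_right _ hb)
    rcases hw with hw | hw
    · refine hpush₁ (ht₁.edge_mem w hw w' ?_ hww')
      rcases hw' with (h | h) | h
      · exact Or.inl h
      · exact (hn hw h hww').elim
      · exact Or.inr h
    · refine hpush₂ (ht₂.edge_mem w hw w' ?_ hww')
      rcases hw' with (h | h) | h
      · exact (hn h hw hww'.symm).elim
      · exact Or.inl h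
      · exact Or.inr h
  · intro x hx w hw hxw
    rcases (hL_iff w).1 hw with hw | hw
    · exact hpush₁ (ht₁.edge_lower x hx w hw hxw)
    · exact hpush₂ (ht₂.edge_lower x hx w hw hxw)
  · intro x hx hl hr w hw hxw
    by_cases h1 : ∃ w ∈ L₁, G.Adj x w
    · by_cases h2 : ∃ w ∈ L₂, G.Adj x w
      · exact ⟨_, Or.inl rfl, (hlo x).2 (Or.inr ⟨hx, Or.inr ⟨h1, h2⟩⟩), (hlo w).2 (Or.inl hw)⟩
      · push Not at h2
        refine hpush₁ (ht₁.edge_bag x hx h1 (fun w' hw' => ?_) w hw hxw)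
        exact (Finset.mem_union.1 hw').elim (hr w') (h2 w')
    · have h2 := ((hl_iff x).1 hl).resolve_left h1
      push Not at h1
      refine hpush₂ (ht₂.edge_bag x hx h2 (fun w' hw' => ?_) w hw hxw)
      exact (Finset.mem_union.1 hw').elim (hr w') (h1 w')

/-- A valid quintuple of partial treewidth at most `k` is realized by a tree decomposition with bags
of size at most `k + 1`. -/
theorem exists_realizes (hC : ∀ x ∉ C, ∀ w, G.Adj x w → w ∈ C) (Q : Quintuple V)
    (hQ : IsValid G univ C Q) (hk : ptw G univ C Q ≤ (k : WithTop ℤ)) :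
    ∃ t, Realizes G C k Q t := by
  -- The weight 2 is for the forget case, where `L` loses a vertex and `X` gains one.
  induction hn : 2 * Q.L.card + Q.X.card using Nat.strong_induction_on generalizing Q with
  | _ n ih =>
    have hloc : loctw G C Q ≤ k := WithTop.coe_le_coe.1 ((loctw_le_ptw Q).trans hk)
    suffices h : ∃ t, PreRealizes G C k Q t by
      obtain ⟨t, ht⟩ := h
      exact ⟨_, ht.realizes hQ.separates hloc⟩
    by_cases hL : Q.L = ∅
    · exact ⟨_, preRealizes_leaf hQ.separates hL hloc⟩
    obtain ⟨lo, L, X, R, hi⟩ := Q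
    cases lo with
    | introduce u =>
      obtain ⟨hu, -, τ, hτ, hτk⟩ := (ptw_introduce_le_iff hL).1 hk
      have hlt : (X \ {u}).card < X.card := Finset.card_lt_card
        (Finset.sdiff_ssubset (Finset.singleton_subset_iff.2 hu) (Finset.singleton_nonempty u))
      obtain ⟨t, ht⟩ := ih _ (by rw [← hn]; simp only; omega) _ hτ hτk rfl
      exact ⟨_, PreRealizes.introduce hC hL hu hQ.separates hτ.separates hloc ht⟩
    | forget u =>
      obtain ⟨hu, -, τ, hτ, hτk⟩ := (ptw_forget_le_iff hL).1 hk
      have hlt : (L \ {u}).card < L.card := Finset.card_lt_card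
        (Finset.sdiff_ssubset (Finset.singleton_subset_iff.2 hu) (Finset.singleton_nonempty u))
      have hle := Finset.card_union_le X {u}
      rw [Finset.card_singleton] at hle
      obtain ⟨t, ht⟩ := ih _ (by rw [← hn]; simp only; omega) _ hτ hτk rfl
      exact exists_preRealizes_forget hC hu hQ.separates hτ.separates
        (WithTop.coe_le_coe.1 ((loctw_le_ptw _).trans hτk)) ht
    | join X' L₁ L₂ =>
      obtain ⟨⟨hlt₁, hlt₂⟩, -, ⟨τ₁, hτ₁, hτk₁⟩, τ₂, hτ₂, hτk₂⟩ := (ptw_join_le_iff hL).1 hk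
      simp only at hn hlt₁ hlt₂
      obtain ⟨t₁, ht₁⟩ := ih _ (by rw [← hn]; simp only; omega) _ hτ₁ hτk₁ rfl
      obtain ⟨t₂, ht₂⟩ := ih _ (by rw [← hn]; simp only; omega) _ hτ₂ hτk₂ rfl
      exact ⟨_, PreRealizes.join hL hQ.separates hτ₁.separates hτ₂.separates hloc ht₁ ht₂⟩

/-- A valid last quintuple of partial treewidth at most `k` gives a tree decomposition of width at
most `k`. -/
theorem exists_width_le (hC : ∀ x ∉ C, ∀ w, G.Adj x w → w ∈ C)
    (h : Feasible G univ C k (C \ {univ}) {univ} ∅ (.forget univ)) :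
    ∃ D : TreeDecomp G, D.width ≤ k := by
  classical
  obtain ⟨τ, hτ, hk⟩ := h
  obtain ⟨t, ht⟩ := exists_realizes hC _ hτ hk
  have hXR : ∀ x, x ∉ XR G C ⟨τ, C \ {univ}, {univ}, ∅, .forget univ⟩ := fun x hx => by
    obtain ⟨-, -, -, w, hw, -⟩ := mem_XR.1 hx
    simp at hw
  -- The only vertices still missing are those outside `C` with no neighbour other than `univ`.
  obtain ⟨t', h1, h2, -, h4, h5, h6⟩ := exists_attach (G := G) ht.conn ht.card_le
    (Finset.univ.filter fun x => x ∉ C ∧ ∀ w, G.Adj x w → w = univ) (by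
      intro x hx
      simp only [Finset.mem_filter, Finset.mem_univ, true_and] at hx
      obtain ⟨hxC, hN⟩ := hx
      constructor
      · rw [ht.verts_notMem x hxC]
        rintro (⟨w, hw, hxw⟩ | h)
        · exact (Finset.mem_sdiff.1 hw).2 (Finset.mem_singleton.2 (hN w hxw))
        · exact hXR x h
      · obtain ⟨b, hb, hb'⟩ := exists_leaf_bag (WithTop.coe_le_coe.1 ((loctw_le_ptw _).trans hk))
          hxC fun w hw => Finset.mem_singleton.2 (hN w hw)
        refine ⟨b, hb.trans fun v hv => ?_, hb'⟩
        rw [ht.top_eq, mem_bagHi]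
        exact Or.inl hv)
  simp only [Finset.mem_filter, Finset.mem_univ, true_and] at h4 h6
  have hcases : ∀ x ∉ C, (∃ w ∈ C \ {univ}, G.Adj x w) ∨ ∀ w, G.Adj x w → w = univ := by
    intro x hx
    by_cases h : ∃ w ∈ C \ {univ}, G.Adj x w
    · exact Or.inl h
    · refine Or.inr fun w hw => by_contra fun hwu => h ⟨w, ?_, hw⟩
      simpa [hwu] using hC x hx w hw
  have hpush : ∀ {a b : V}, (∃ c, t.HasBag c ∧ a ∈ c ∧ b ∈ c) →
      ∃ c, t'.HasBag c ∧ a ∈ c ∧ b ∈ c := fun ⟨c, hc, h⟩ => ⟨c, h5 c hc, h⟩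
  have hverts : ∀ v, t'.Verts v := by
    intro v
    rw [h4]
    by_cases hv : v ∈ C
    · right
      rw [ht.verts_mem v hv]
      simp only [Finset.mem_sdiff, Finset.mem_singleton]
      tauto
    · rcases hcases v hv with h | h
      · exact Or.inr ((ht.verts_notMem v hv).2 (Or.inl h))
      · exact Or.inl ⟨hv, h⟩
  have hS : ∀ x ∉ C, ∀ w, G.Adj x w → ∃ c, t'.HasBag c ∧ x ∈ c ∧ w ∈ c := by
    intro x hx w hxw
    rcases hcases x hx with h | h
    · by_cases hwu : w = univ
      · exact hpush (ht.edge_bag x hx h (by simp) w (by simp [hwu]) hxw)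
      · exact hpush (ht.edge_lower x hx w (by simpa [hwu] using hC x hx w hxw) hxw)
    · exact h6 x ⟨hx, h⟩ w hxw
  -- Every edge inside `C` has an endpoint other than `univ`, that is, in `L`.
  have hcov : ∀ {a b : V}, a ∈ C → a ≠ univ → b ∈ C → G.Adj a b →
      ∃ c, t'.HasBag c ∧ a ∈ c ∧ b ∈ c := by
    intro a b ha hau hb hab
    refine hpush (ht.edge_mem a (by simp [ha, hau]) b ?_ hab)
    simp only [Finset.mem_sdiff, Finset.mem_singleton]
    tauto
  have hedges : ∀ u v, G.Adj u v → ∃ c, t'.HasBag c ∧ u ∈ c ∧ v ∈ c := by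
    intro u v huv
    by_cases hu : u ∈ C
    · by_cases hv : v ∈ C
      · by_cases huu : u = univ
        · obtain ⟨c, hc, h, h'⟩ := hcov hv (fun h => huv.ne (huu.trans h.symm)) hu huv.symm
          exact ⟨c, hc, h', h⟩
        · exact hcov hu huu hv huv
      · obtain ⟨c, hc, h, h'⟩ := hS v hv u huv.symm
        exact ⟨c, hc, h', h⟩
    · exact hS u hu v huv
  exact ⟨(t'.toRooted h1 hverts hedges).toTreeDecomp, toRooted_width_le h2⟩

end VCTreewidth

/-! ### The treewidth as an attained minimum, and the conclusion. -/

namespace VCTreewidth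

variable {V : Type*} {G : SimpleGraph V}

/-- The treewidth is attained. -/
theorem isLeast_treewidth [Fintype V] :
    IsLeast {w : ℤ | ∃ D : TreeDecomp G, D.width = w} (treewidth G) := by
  have hne : {w : ℤ | ∃ D : TreeDecomp G, D.width = w}.Nonempty := by
    let t : BagTree V := .leaf Finset.univ
    refine ⟨_, (t.toRooted (G := G) trivial (fun v => ?_) fun u v _ => ?_).toTreeDecomp, rfl⟩
    · exact BagTree.verts_leaf.2 (Finset.mem_univ v)
    · exact ⟨_, rfl, Finset.mem_univ u, Finset.mem_univ v⟩
  have hb : BddBelow {w : ℤ | ∃ D : TreeDecomp G, D.width = w} := by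
    refine ⟨-1, ?_⟩
    rintro w ⟨D, rfl⟩
    unfold TreeDecomp.width
    omega
  exact ⟨Int.csInf_mem hne hb, fun w hw => csInf_le hb hw⟩

theorem TreeDecomp.card_bag_le (D : TreeDecomp G) (i : D.I) :
    ((D.bag i).card : ℤ) ≤ D.width + 1 := by
  have : (D.bag i).card ≤ Finset.univ.sup fun i => (D.bag i).card :=
    Finset.le_sup (f := fun i => (D.bag i).card) (Finset.mem_univ i)
  unfold TreeDecomp.width
  omega

/-- The treewidth is at most `k` iff some valid last quintuple has partial treewidth at most `k`. -/
theorem treewidth_le_iff [Fintype V] [DecidableEq V] {univ : V} {C : Finset V}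
    (hC : ∀ x ∉ C, ∀ w, G.Adj x w → w ∈ C) (hmem : univ ∈ C) {k : ℤ} :
    treewidth G ≤ k ↔ Feasible G univ C k (C \ {univ}) {univ} ∅ (.forget univ) := by
  constructor
  · intro hk
    obtain ⟨D, hD⟩ := (isLeast_treewidth (G := G)).1
    obtain ⟨i₀⟩ := D.isTree.connected.nonempty
    have hpos : 0 ≤ D.width + 1 := le_trans (by positivity) (D.card_bag_le i₀)
    obtain ⟨n, hn⟩ := Int.eq_ofNat_of_zero_le hpos
    obtain ⟨D', hnice, hcard⟩ := D.exists_isNice (n := n)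
      (fun i => by have := D.card_bag_le i; omega) univ
    exact RootedTreeDecomp.feasible_root hnice (fun i => by have := hcard i; omega) hmem
  · intro h
    obtain ⟨D, hD⟩ := exists_width_le hC h
    exact ((isLeast_treewidth (G := G)).2 ⟨D, rfl⟩).trans hD

end VCTreewidth

theorem mainTheorem3 {V : Type*} [Fintype V] [DecidableEq V] (G : SimpleGraph V)
    (univ : V) (huniv : ∀ v : V, v ≠ univ → G.Adj univ v)
    (C : Finset V) (hC : G.IsVertexCover (C : Set V)) (hmem : univ ∈ C) :
    IsLeast
      {t : WithTop ℤ | ∃ τ : VCTreewidth.Op V,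
        VCTreewidth.IsValid G univ C ⟨τ, C \ {univ}, {univ}, ∅, .forget univ⟩ ∧
        VCTreewidth.ptw G univ C ⟨τ, C \ {univ}, {univ}, ∅, .forget univ⟩ = t}
      ((VCTreewidth.treewidth G : ℤ) : WithTop ℤ) := by
  -- The complement of a vertex cover is independent.
  have hN : ∀ x ∉ C, ∀ w, G.Adj x w → w ∈ C := fun x hx w hxw => by
    simpa [hx] using hC hxw
  have hlow : ∀ τ, VCTreewidth.IsValid G univ C ⟨τ, C \ {univ}, {univ}, ∅, .forget univ⟩ →
      ((VCTreewidth.treewidth G : ℤ) : WithTop ℤ) ≤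
        VCTreewidth.ptw G univ C ⟨τ, C \ {univ}, {univ}, ∅, .forget univ⟩ := by
    intro τ hτ
    generalize hp : VCTreewidth.ptw G univ C ⟨τ, C \ {univ}, {univ}, ∅, .forget univ⟩ = p
    induction p using WithTop.recTopCoe with
    | top => exact le_top
    | coe k =>
      exact WithTop.coe_le_coe.2 ((VCTreewidth.treewidth_le_iff hN hmem).2 ⟨τ, hτ, hp.le⟩)
  -- Taking `k` equal to the treewidth gives existence and attainment at once.
  obtain ⟨τ, hτ, hk⟩ := (VCTreewidth.treewidth_le_iff hN hmem).1 le_rfl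
  refine ⟨⟨τ, hτ, le_antisymm hk (hlow τ hτ)⟩, ?_⟩
  rintro t ⟨τ', hτ', rfl⟩
  exact hlow τ' hτ'
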